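/- **Setting.** A graph has a set of vertices and a set of directed edges; each directed edge $e$ has an origin $o(e)$, a terminus $t(e)$ and an inverse $\bar e\neq e$ with $\bar{\bar e}=e$, $o(\bar e)=t(e)$; loops and multiple edges are allowed. A $d$-dimensional topological crystal ($d\ge 1$) is a connected regular covering graph $X=(V,E)$ of a finite connected graph $X_0=(V_0,E_0)$ whose covering transformation group $L$ is free abelian of rank $d$. All vertex degrees $|\{e : o(e)=x\}|$ are assumed to be at least $3$. A periodic realization of $X$ is a map $\Phi:X\to\mathbb R^d$ on the 1-dimensional cell complex $X$, affine on each edge, such that $\Phi(\sigma x)=\Phi(x)+\rho(\sigma)$ for $\sigma\in L$, where $\rho:L\to\mathbb R^d$ is an injective homomorphism whose image (the period lattice) is a lattice in $\mathbb R^d$. The vectors $\Phi(t(e))-\Phi(o(e))$ depend only on the image of $e$ in $E_0$; this defines the building cochain $\mathbf v:E_0\to\mathbb R^d$. Give $C_1(X_0,\mathbb R)$ (where $\bar e=-e$) the inner product for which the edges of an orientation are an orthonormal basis. Let $H\subset H_1(X_0,\mathbb Z)$ be the kernel of the canonical map $H_1(X_0,\mathbb Z)\to L$ (equivalently, the image of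 $H_1(X,\mathbb Z)$ under the covering map), $H_{\mathbb R}\subset H_1(X_0,\mathbb R)$ its real span, and $H_{\mathbb R}^\perp$ the orthogonal complement of $H_{\mathbb R}$ in $H_1(X_0,\mathbb R)$, of dimension $d$. Let $P_0:C_1(X_0,\mathbb R)\to H_1(X_0,\mathbb R)$ and $P:H_1(X_0,\mathbb R)\to H_{\mathbb R}^\perp$ be the orthogonal projections. A realization is a *normalized standard realization* if, after $H_{\mathbb R}^\perp$ is identified with $\mathbb R^d$ by an orthonormal basis, its building cochain is $e\mapsto P(P_0(e))$; a *standard realization* is the composition of a normalized one with a similarity of $\mathbb R^d$. **Theorem.** Let $\Phi:X\to\mathbb R^d$ be an injective periodic realization of a $d$-dimensional topological crystal $X$ over $X_0$ (injective on the whole cell complex, so that distinct vertices have distinct images and edges do not overlap or cross). Let $\Gamma$ be a group of congruence transformations of $\mathbb R^d$ that preserves the set $\Phi(X)$ and contains the translations by the period lattice. Let $K\subset O(d)$ be its point group, i.e. the group of linear parts of elements of $\Gamma$, and for $p\in\mathbb R^d$ let $\Gamma_p=\{g\in\Gamma : g(p)=p\}$, which acts on $\mathbb R^d$ through linear parts.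 Suppose that 1. $K$ acts irreducibly on $\mathbb R^d$, and 2. for every vertex $x\in V$, the only vector of $\mathbb R^d$ fixed by the linear parts of all elements of $\Gamma_{\Phi(x)}$ is $\mathbf 0$. Then $\Phi$ is a standard realization. Moreover, its building vectors $\{\mathbf v(e)\}_{e\in E_0}$ form a tight frame, i.e. they span $\mathbb R^d$ and there is $\alpha>0$ with $\sum_{e\in E_0}\langle \mathbf x,\mathbf v(e)\rangle\,\mathbf v(e)=\alpha\mathbf x$ for all $\mathbf x\in\mathbb R^d$, and they are harmonic: $\sum_{e\in E_0,\ o(e)=x}\mathbf v(e)=\mathbf 0$ for every $x\in V_0$. -/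

import Mathlib

namespace TopCrystal

/-- A graph given by its directed edges, with loops and multiple edges allowed.
Every edge occurs with its two directions `e` and `inv e`, which are distinct. -/
structure DirGraph (V E : Type*) where
  /-- origin -/
  o : E → V
  /-- terminus -/
  t : E → V
  /-- inversion of directed edges -/
  inv : E → E
  inv_inv : ∀ e, inv (inv e) = e
  inv_ne : ∀ e, inv e ≠ e
  o_inv : ∀ e, o (inv e) = t e

namespace DirGraph

variable {V E : Type*}

theorem t_inv (X : DirGraph V E) (e : E) : X.t (X.inv e) = X.o e := by
  rw [← X.o_inv, X.inv_inv]

/-- Nonempty, and any two vertices are joined by a path of directed edges. -/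
def Connected (X : DirGraph V E) : Prop :=
  Nonempty V ∧
    ∀ x y : V, Relation.ReflTransGen (fun a b => ∃ e, X.o e = a ∧ X.t e = b) x y

/-- The degree of a vertex: the number of directed edges with origin `x`. -/
noncomputable def degree (X : DirGraph V E) (x : V) : ℕ := Nat.card {e : E // X.o e = x}

/-! ### The graph as a one-dimensional cell complex -/

/-- The gluing that builds the one-dimensional cell complex of a graph from its vertices and
from one unit interval for each directed edge: the interval of `e` starts at the origin of `e`,
and the interval of `inv e` is that of `e` run backwards. -/
inductive Glue (X : DirGraph V E) : V ⊕ E × unitInterval → V ⊕ E × unitInterval → Prop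
  | origin (e : E) : Glue X (Sum.inr (e, 0)) (Sum.inl (X.o e))
  | reverse (e : E) (s : unitInterval) :
      Glue X (Sum.inr (e, s)) (Sum.inr (X.inv e, unitInterval.symm s))

/-- The set of points of the one-dimensional cell complex of a graph. -/
def Space (X : DirGraph V E) : Type _ := Quot X.Glue

/-- The piecewise linear map on the cell complex of `X` that is given by `Φ` on the vertices
and is affine on each edge. -/
noncomputable def plMap {F : Type*} [AddCommGroup F] [Module ℝ F]
    (X : DirGraph V E) (Φ : V → F) : X.Space → F :=
  Quot.lift
    (Sum.elim Φ fun p => AffineMap.lineMap (Φ (X.o p.1)) (Φ (X.t p.1)) (p.2 : ℝ))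
    (by
      intro a b h
      cases h with
      | origin e => simp
      | reverse e s =>
        simp [X.o_inv, X.t_inv, AffineMap.lineMap_apply_one_sub])

/-! ### Chains and homology -/

/-- The group `C₁(X, K)` of 1-chains, in which `inv e = -e`: finitely supported functions on
directed edges that are odd under inversion. -/
def chains (K : Type*) [CommRing K] (X : DirGraph V E) : Submodule K (E →₀ K) where
  carrier := {c | ∀ e, c (X.inv e) = -c e}
  add_mem' := by
    intro a b ha hb e
    simp only [Finsupp.add_apply, ha e, hb e]
    ring
  zero_mem' := by intro e; simp
  smul_mem' := by
    intro k a ha e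
    simp [ha e]

/-- The 1-chain of a directed edge. -/
noncomputable def edgeChain (K : Type*) [CommRing K] (X : DirGraph V E) (e : E) :
    X.chains K :=
  ⟨Finsupp.single e 1 - Finsupp.single (X.inv e) 1, by
    classical
    intro f
    have h1 : X.inv e = X.inv f ↔ e = f :=
      ⟨fun h => by rw [← X.inv_inv e, h, X.inv_inv], fun h => by rw [h]⟩
    have h2 : e = X.inv f ↔ X.inv e = f :=
      ⟨fun h => by rw [h, X.inv_inv], fun h => by rw [← h, X.inv_inv]⟩
    simp only [Finsupp.sub_apply, Finsupp.single_apply, h1, h2]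
    ring⟩

/-- The boundary operator `∂ : C₁(X, K) → C₀(X, K)`. The value of `∂ c` at `x` is the sum of
`c e` over the directed edges `e` with terminus `x`. -/
noncomputable def boundary (K : Type*) [CommRing K] (X : DirGraph V E) :
    X.chains K →ₗ[K] (V →₀ K) :=
  (Finsupp.lmapDomain K K X.t).comp (X.chains K).subtype

/-- The boundary of a directed edge is its terminus minus its origin. -/
theorem boundary_edgeChain (K : Type*) [CommRing K] (X : DirGraph V E) (e : E) :
    X.boundary K (X.edgeChain K e) = Finsupp.single (X.t e) 1 - Finsupp.single (X.o e) 1 := by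
  simp [boundary, edgeChain, Finsupp.mapDomain_sub, Finsupp.mapDomain_single, X.t_inv]

/-- The first homology group `H₁(X, K) = ker ∂`. -/
noncomputable def H1 (K : Type*) [CommRing K] (X : DirGraph V E) : Submodule K (X.chains K) :=
  LinearMap.ker (X.boundary K)

/-- The inner product on `C₁(X, ℝ)` of a finite graph for which the directed edges of any
orientation form an orthonormal basis. Every edge is counted with both of its directions,
whence the factor `1 / 2`. -/
noncomputable instance chainsCore [Fintype E] (X : DirGraph V E) :
    InnerProductSpace.Core ℝ (X.chains ℝ) where
  inner a b := (1 / 2) * ∑ e, a.1 e * b.1 e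
  conj_inner_symm a b := by simp [mul_comm]
  re_inner_nonneg a := by
    have : 0 ≤ ∑ e, a.1 e * a.1 e := Finset.sum_nonneg fun e _ => mul_self_nonneg _
    simpa using this
  add_left a b c := by
    simp [add_mul, Finset.sum_add_distrib, mul_add]
  smul_left a b r := by
    simp only [Submodule.coe_smul, Finsupp.smul_apply, smul_eq_mul, mul_assoc,
      ← Finset.mul_sum, conj_trivial]
    ring
  definite a h := by
    have h' : ∑ e, a.1 e * a.1 e = 0 := by
      have : (1 / 2 : ℝ) * ∑ e, a.1 e * a.1 e = 0 := h
      linarith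
    rw [Finset.sum_eq_zero_iff_of_nonneg fun e _ => mul_self_nonneg _] at h'
    ext e
    exact mul_self_eq_zero.mp (h' e (Finset.mem_univ e))

noncomputable instance chainsNormedAddCommGroup [Fintype E] (X : DirGraph V E) :
    NormedAddCommGroup (X.chains ℝ) :=
  (X.chainsCore).toNormedAddCommGroup

noncomputable instance chainsInnerProductSpace [Fintype E] (X : DirGraph V E) :
    InnerProductSpace ℝ (X.chains ℝ) :=
  InnerProductSpace.ofCore (X.chainsCore).toCore

/-- The inner product of a directed edge with a 1-chain is the coefficient of the edge. In
particular `⟨e, e⟩ = 1`, `⟨e, inv e⟩ = -1`, and `⟨e, f⟩ = 0` for all other directed edges `f`. -/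
theorem inner_edgeChain_left [Fintype E] (X : DirGraph V E) (e : E) (c : X.chains ℝ) :
    inner ℝ (X.edgeChain ℝ e) c = c.1 e := by
  classical
  have hdef : inner ℝ (X.edgeChain ℝ e) c =
      (1 / 2) * ∑ g, (X.edgeChain ℝ e).1 g * c.1 g := rfl
  have hc : c.1 (X.inv e) = -c.1 e := c.2 e
  rw [hdef]
  simp only [edgeChain, Finsupp.sub_apply, Finsupp.single_apply, sub_mul,
    Finset.sum_sub_distrib, ite_mul, one_mul, zero_mul,
    Finset.sum_ite_eq, Finset.mem_univ, if_true, hc]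
  ring

end DirGraph

/-! ### Topological crystals -/

section Crystal

variable {V E V₀ E₀ : Type*}

/-- `X` is a `d`-dimensional topological crystal over the finite graph `X₀`: a connected,
infinite-fold, regular covering graph `(pV, pE) : X → X₀` whose covering transformation group
is the free abelian group `L` of rank `d`. Since `X` is connected and `L` acts simply
transitively on the fibers, `L` is the whole group of covering transformations. -/
structure IsTopologicalCrystal (d : ℕ) (L : Type*) [AddCommGroup L] [AddAction L V]
    [AddAction L E] (X : DirGraph V E) (X₀ : DirGraph V₀ E₀) (pV : V → V₀) (pE : E → E₀) :
    Prop where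
  finite_vertices : Finite V₀
  finite_edges : Finite E₀
  connected_base : X₀.Connected
  connected : X.Connected
  /-- `(pV, pE)` is a morphism of graphs -/
  map_o : ∀ e, X₀.o (pE e) = pV (X.o e)
  map_t : ∀ e, X₀.t (pE e) = pV (X.t e)
  map_inv : ∀ e, pE (X.inv e) = X₀.inv (pE e)
  /-- it is surjective on vertices, and bijective on the edges that start at a vertex -/
  surjective : Function.Surjective pV
  lift_edge : ∀ (x : V) (e₀ : E₀), X₀.o e₀ = pV x → ∃! e : E, X.o e = x ∧ pE e = e₀
  /-- `L` acts by automorphisms of the graph `X` -/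
  vadd_o : ∀ (σ : L) (e : E), X.o (σ +ᵥ e) = σ +ᵥ X.o e
  vadd_t : ∀ (σ : L) (e : E), X.t (σ +ᵥ e) = σ +ᵥ X.t e
  vadd_inv : ∀ (σ : L) (e : E), X.inv (σ +ᵥ e) = σ +ᵥ X.inv e
  /-- these automorphisms are covering transformations -/
  map_vadd_vertex : ∀ (σ : L) (x : V), pV (σ +ᵥ x) = pV x
  map_vadd_edge : ∀ (σ : L) (e : E), pE (σ +ᵥ e) = pE e
  /-- `L` acts simply transitively on each fiber -/
  simply_transitive : ∀ x y : V, pV x = pV y → ∃! σ : L, σ +ᵥ x = y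
  /-- `L` is free abelian of rank `d`, and infinite -/
  free : Module.Free ℤ L
  finitely_generated : Module.Finite ℤ L
  rank_eq : Module.finrank ℤ L = d
  infinite_fold : 0 < d

/-- The map `Φ` on the vertices (extended affinely to the edges) is a periodic realization of
`X` with period homomorphism `ρ`: it is equivariant, and `ρ` is injective with image a lattice,
that is, a discrete subgroup that spans the space. -/
structure IsPeriodicRealization {d : ℕ} {L : Type*} [AddCommGroup L] [AddAction L V]
    (Φ : V → EuclideanSpace ℝ (Fin d)) (ρ : L →+ EuclideanSpace ℝ (Fin d)) : Prop where
  equivariant : ∀ (σ : L) (x : V), Φ (σ +ᵥ x) = Φ x + ρ σ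
  injective : Function.Injective ρ
  discrete : DiscreteTopology ρ.range
  span_eq_top : Submodule.span ℝ (Set.range ρ) = ⊤

/-- `v` is the building cochain of `Φ`, seen as a function on the directed edges of `X₀`. -/
def IsBuildingCochain {d : ℕ} (X : DirGraph V E) (pE : E → E₀)
    (Φ : V → EuclideanSpace ℝ (Fin d)) (v : E₀ → EuclideanSpace ℝ (Fin d)) : Prop :=
  ∀ e : E, v (pE e) = Φ (X.t e) - Φ (X.o e)

/-! ### Standard realizations -/

/-- The subspace `H_ℝ` of `H₁(X₀, ℝ)` spanned by the vanishing subgroup `H`. The vanishing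
subgroup is the kernel of the canonical map `H₁(X₀, ℤ) → L`; by the theory of covering spaces
this is the image of `H₁(X, ℤ)` in `H₁(X₀, ℤ)` under the covering map. -/
noncomputable def vanishingSpace (X : DirGraph V E) (X₀ : DirGraph V₀ E₀) (pE : E → E₀) :
    Submodule ℝ (X₀.chains ℝ) :=
  Submodule.span ℝ {c | ∃ z ∈ X.H1 ℤ, ∀ e₀ : E₀,
    c.1 e₀ = ((Finsupp.mapDomain pE z.1 e₀ : ℤ) : ℝ)}

/-- The orthogonal complement of `H_ℝ` in `H₁(X₀, ℝ)`. -/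
noncomputable def vanishingSpacePerp [Fintype E₀] (X : DirGraph V E) (X₀ : DirGraph V₀ E₀)
    (pE : E → E₀) : Submodule ℝ (X₀.chains ℝ) :=
  X₀.H1 ℝ ⊓ (vanishingSpace X X₀ pE)ᗮ

/-- `v₀(e)`, the orthogonal projection of the directed edge `e` to `H₁(X₀, ℝ)`. -/
noncomputable def harmonicEdge [Fintype E₀] (X₀ : DirGraph V₀ E₀) (e : E₀) : X₀.H1 ℝ :=
  (X₀.H1 ℝ).orthogonalProjectionOnto (X₀.edgeChain ℝ e)

/-- The building cochain `P(v₀(e))` of the normalized standard realization, where `P` is the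
orthogonal projection of `H₁(X₀, ℝ)` to the orthogonal complement of `H_ℝ`. -/
noncomputable def standardCochain [Fintype E₀] (X : DirGraph V E) (X₀ : DirGraph V₀ E₀)
    (pE : E → E₀) (e : E₀) : vanishingSpacePerp X X₀ pE :=
  (vanishingSpacePerp X X₀ pE).orthogonalProjectionOnto (harmonicEdge X₀ e : X₀.chains ℝ)

/-- `Φ` is a normalized standard realization: its building cochain is `P(v₀(e))`, the orthogonal
complement of `H_ℝ` being identified with `ℝᵈ` through an orthonormal basis. -/
def IsNormalizedStandardRealization {d : ℕ} [Fintype E₀] (X : DirGraph V E)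
    (X₀ : DirGraph V₀ E₀) (pE : E → E₀) (Φ : V → EuclideanSpace ℝ (Fin d)) : Prop :=
  ∃ ι : vanishingSpacePerp X X₀ pE ≃ₗᵢ[ℝ] EuclideanSpace ℝ (Fin d),
    IsBuildingCochain X pE Φ fun e => ι (standardCochain X X₀ pE e)

/-- `Φ` is a standard realization: it is obtained from a normalized standard realization by a
similarity of `ℝᵈ`. -/
def IsStandardRealization {d : ℕ} [Fintype E₀] (X : DirGraph V E)
    (X₀ : DirGraph V₀ E₀) (pE : E → E₀) (Φ : V → EuclideanSpace ℝ (Fin d)) : Prop :=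
  ∃ Φ₀ : V → EuclideanSpace ℝ (Fin d), IsNormalizedStandardRealization X X₀ pE Φ₀ ∧
    ∃ (r : ℝ) (U : EuclideanSpace ℝ (Fin d) ≃ₗᵢ[ℝ] EuclideanSpace ℝ (Fin d))
      (b : EuclideanSpace ℝ (Fin d)), 0 < r ∧ ∀ x, Φ x = r • U (Φ₀ x) + b

/-- A finite family of vectors is a tight frame: it generates the space, and its frame operator
is a positive multiple of the identity. -/
def IsTightFrame {d : ℕ} {I : Type*} [Fintype I] (v : I → EuclideanSpace ℝ (Fin d)) : Prop :=
  Submodule.span ℝ (Set.range v) = ⊤ ∧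
    ∃ α : ℝ, 0 < α ∧ ∀ x : EuclideanSpace ℝ (Fin d), ∑ i, inner ℝ x (v i) • v i = α • x

open Classical in
/-- At every vertex the sum of the values of the cochain on the edges starting there is zero. -/
def IsHarmonic {d : ℕ} [Fintype E₀] (X₀ : DirGraph V₀ E₀)
    (v : E₀ → EuclideanSpace ℝ (Fin d)) : Prop :=
  ∀ x : V₀, ∑ e with X₀.o e = x, v e = 0

end Crystal

/-! ### Groups of congruence transformations -/

section Congruence

variable {F : Type*} [NormedAddCommGroup F] [InnerProductSpace ℝ F]

/-- The homomorphism that maps a congruence transformation to its linear part. -/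
noncomputable def linearPart : (F ≃ᵃⁱ[ℝ] F) →* (F ≃ₗᵢ[ℝ] F) where
  toFun g := g.linearIsometryEquiv
  map_one' := by ext v; rfl
  map_mul' g h := by ext v; rfl

/-- The point group of a group of congruence transformations. -/
noncomputable def pointGroup (Γ : Subgroup (F ≃ᵃⁱ[ℝ] F)) : Subgroup (F ≃ₗᵢ[ℝ] F) := Γ.map linearPart

/-- The isotropy group `Γ_p` of a point. -/
def isotropyGroup (Γ : Subgroup (F ≃ᵃⁱ[ℝ] F)) (p : F) : Subgroup (F ≃ᵃⁱ[ℝ] F) where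
  carrier := {g | g ∈ Γ ∧ g p = p}
  one_mem' := ⟨Γ.one_mem, rfl⟩
  mul_mem' := by
    rintro g h ⟨hg, hgp⟩ ⟨hh, hhp⟩
    refine ⟨Γ.mul_mem hg hh, ?_⟩
    change g (h p) = p
    rw [hhp, hgp]
  inv_mem' := by
    rintro g ⟨hg, hgp⟩
    refine ⟨Γ.inv_mem hg, ?_⟩
    change g.symm p = p
    rw [AffineIsometryEquiv.symm_apply_eq, hgp]

/-- A group of orthogonal transformations acts irreducibly. -/
def ActsIrreducibly (K : Subgroup (F ≃ₗᵢ[ℝ] F)) : Prop :=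
  Nontrivial F ∧
    ∀ W : Submodule ℝ F, (∀ g ∈ K, ∀ w ∈ W, g w ∈ W) → W = ⊥ ∨ W = ⊤

end Congruence

end TopCrystal

/-! The vertices are the points of `Φ(X)` at which at least three directions are tangent to `Φ(X)`,
so every congruence transformation that preserves `Φ(X)` permutes the embedded vertices and
directed edges.

At a vertex `x`, the sum of the edge vectors starting at `x` is fixed by the linear parts of the
isotropy group of `Φ(x)`, hence zero: `v` is harmonic.

A symmetry of `Φ(X)` need not normalize the period lattice, so it need not act on the edges of `X₀`.
It induces a correspondence instead, in which every edge of `X₀` is related to the same finite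
number of edges, namely the index of the period lattice in the group of all translations that
preserve `Φ(X)`. By double counting, the frame operator of `v` commutes with the point group, and by
irreducibility it is a positive scalar.

Finally, `y ↦ (e ↦ ⟨y, v(e)⟩)` takes values in the cycles orthogonal to `H_ℝ`, since `v` is harmonic
and lifts to the coboundary of `Φ`. It is onto, because such a cycle lifts to the coboundary of a
function on `V` that is the sum of a linear function of `Φ` and an `L`-invariant function, and a
cycle of `X₀` that is a coboundary is zero. As `v` is a tight frame it is a similarity, and its
adjoint maps the edge `e` to `v(e)`. -/

namespace TopCrystal

open Filter Topology DirGraph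
open scoped Pointwise

/-! ### Injective realizations -/

namespace DirGraph

variable {V E : Type*} {X : DirGraph V E}

/-- The parameters of a point in the interior of an edge: one pair `(e, s)` with `0 < s < 1` for
each of the two directions of the edge. A vertex has none. These are invariant under the gluing,
so they separate the points of the cell complex. -/
def innerParams (X : DirGraph V E) : X.Space → Set (E × ℝ) :=
  Quot.lift
    (Sum.elim (fun _ => ∅) fun p =>
      {q | q.2 ∈ Set.Ioo 0 1 ∧ (q = (p.1, (p.2 : ℝ)) ∨ q = (X.inv p.1, 1 - (p.2 : ℝ)))})
    (by
      intro a b h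
      cases h with
      | origin e =>
        ext ⟨f, s⟩
        simp +contextual [iff_def, ne_of_gt, ne_of_lt]
      | reverse e s => ext q; simp [X.inv_inv, or_comm])

section Realization

variable {F : Type*} [AddCommGroup F] {Φ : V → F}

/-- The vector `Φ(t(e)) - Φ(o(e))` of an edge of the covering graph. -/
def edgeVec (X : DirGraph V E) (Φ : V → F) (e : E) : F := Φ (X.t e) - Φ (X.o e)

theorem edgeVec_inv (e : E) : X.edgeVec Φ (X.inv e) = -X.edgeVec Φ e := by
  simp [edgeVec, X.o_inv, X.t_inv]

variable [Module ℝ F]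

/-- The affine parametrization of the line through an edge, for which the edge itself is the image
of the unit interval. -/
noncomputable def edgeLine (X : DirGraph V E) (Φ : V → F) (e : E) : ℝ →ᵃ[ℝ] F :=
  AffineMap.lineMap (Φ (X.o e)) (Φ (X.t e))

theorem edgeLine_apply (e : E) (s : ℝ) :
    X.edgeLine Φ e s = Φ (X.o e) + s • X.edgeVec Φ e := by
  rw [edgeLine, AffineMap.lineMap_apply_module', add_comm, edgeVec]

@[simp]
theorem edgeLine_zero (e : E) : X.edgeLine Φ e 0 = Φ (X.o e) :=
  AffineMap.lineMap_apply_zero _ _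

@[simp]
theorem edgeLine_one (e : E) : X.edgeLine Φ e 1 = Φ (X.t e) :=
  AffineMap.lineMap_apply_one _ _

theorem mem_range_plMap_iff (ho : Function.Surjective X.o) {p : F} :
    p ∈ Set.range (X.plMap Φ) ↔ ∃ e, p ∈ X.edgeLine Φ e '' Set.Icc 0 1 := by
  constructor
  · rintro ⟨⟨x | ⟨e, s⟩⟩, rfl⟩
    · obtain ⟨e, rfl⟩ := ho x
      exact ⟨e, 0, by simp, edgeLine_zero e⟩
    · exact ⟨e, s, s.2, rfl⟩
  · rintro ⟨e, s, hs, rfl⟩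
    exact ⟨Quot.mk _ (Sum.inr (e, ⟨s, hs⟩)), rfl⟩

theorem injective_of_injective_plMap (hinj : Function.Injective (X.plMap Φ)) :
    Function.Injective Φ := by
  classical
  intro x y h
  have hglue : (Quot.mk X.Glue (Sum.inl x) : X.Space) = Quot.mk X.Glue (Sum.inl y) := hinj h
  let ind : V → ℝ := Pi.single x 1
  have hind : ind x = ind y := congrArg (X.plMap ind) hglue
  by_contra hne
  simp [ind, Pi.single_eq_of_ne' hne] at hind

theorem eq_or_eq_inv_of_edgeLine_eq (hinj : Function.Injective (X.plMap Φ)) {e f : E} {s r : ℝ}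
    (hs : s ∈ Set.Ioo (0 : ℝ) 1) (hr : r ∈ Set.Icc (0 : ℝ) 1)
    (h : X.edgeLine Φ e s = X.edgeLine Φ f r) :
    (e = f ∧ s = r) ∨ (e = X.inv f ∧ s = 1 - r) := by
  let s' : unitInterval := ⟨s, hs.1.le, hs.2.le⟩
  have hglue : (Quot.mk X.Glue (Sum.inr (e, s')) : X.Space) =
      Quot.mk X.Glue (Sum.inr (f, ⟨r, hr⟩)) := hinj h
  have hmem : (e, s) ∈ X.innerParams (Quot.mk X.Glue (Sum.inr (e, s'))) := ⟨hs, Or.inl rfl⟩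
  rw [hglue] at hmem
  simpa only [Prod.mk.injEq] using hmem.2

theorem eq_of_edgeLine_eq_vertex (hinj : Function.Injective (X.plMap Φ)) {x : V} {e : E} {s : ℝ}
    (hs : s ∈ Set.Icc (0 : ℝ) 1) (h : X.edgeLine Φ e s = Φ x) :
    (s = 0 ∧ X.o e = x) ∨ (s = 1 ∧ X.t e = x) := by
  have hΦ := injective_of_injective_plMap hinj
  rcases hs.1.eq_or_lt with rfl | hs₀
  · exact Or.inl ⟨rfl, hΦ (by simpa using h)⟩
  rcases hs.2.eq_or_lt with rfl | hs₁
  · exact Or.inr ⟨rfl, hΦ (by simpa using h)⟩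
  have hglue : (Quot.mk X.Glue (Sum.inr (e, ⟨s, hs⟩)) : X.Space) =
      Quot.mk X.Glue (Sum.inl x) := hinj h
  have hmem : (e, s) ∈ X.innerParams (Quot.mk X.Glue (Sum.inr (e, ⟨s, hs⟩))) :=
    ⟨⟨hs₀, hs₁⟩, Or.inl rfl⟩
  rw [hglue] at hmem
  exact hmem.elim

theorem edgeVec_ne_zero (hinj : Function.Injective (X.plMap Φ)) (e : E) :
    X.edgeVec Φ e ≠ 0 := by
  intro h
  have hhalf : X.edgeLine Φ e (1 / 2) = Φ (X.o e) := by rw [edgeLine_apply, h, smul_zero, add_zero]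
  rcases eq_of_edgeLine_eq_vertex hinj (by norm_num) hhalf with ⟨h, -⟩ | ⟨h, -⟩ <;> norm_num at h

theorem eq_of_sameRay_edgeVec (hinj : Function.Injective (X.plMap Φ)) {e f : E}
    (ho : X.o e = X.o f) (h : SameRay ℝ (X.edgeVec Φ e) (X.edgeVec Φ f)) : e = f := by
  obtain ⟨a, b, ha, hb, hab⟩ := h.exists_pos (edgeVec_ne_zero hinj e) (edgeVec_ne_zero hinj f)
  have hc : 0 < a + b + 1 := by positivity
  have hpt : X.edgeLine Φ e (a / (a + b + 1)) = X.edgeLine Φ f (b / (a + b + 1)) := by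
    simp only [edgeLine_apply, ho, div_eq_inv_mul, mul_smul, hab]
  have hlt : a / (a + b + 1) < 1 := (div_lt_one hc).2 (by linarith)
  have hle : b / (a + b + 1) ≤ 1 := (div_le_one hc).2 (by linarith)
  rcases eq_or_eq_inv_of_edgeLine_eq hinj ⟨by positivity, hlt⟩ ⟨by positivity, hle⟩ hpt with h | h
  · exact h.1
  · have := h.2
    field_simp at this
    linarith

theorem degree_le_two_of_parallel (hinj : Function.Injective (X.plMap Φ)) {x : V} {w : F}
    (h : ∀ e, X.o e = x → ∃ c : ℝ, X.edgeVec Φ e = c • w) : X.degree x ≤ 2 := by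
  choose c hc using fun e : {e // X.o e = x} => h e e.2
  have hc₀ (e) : c e ≠ 0 := fun h0 => edgeVec_ne_zero hinj e.1 (by rw [hc, h0, zero_smul])
  have hsign : Function.Injective fun e => 0 < c e := by
    intro e f hef
    have hratio : 0 < c f / c e := by
      rcases (hc₀ e).lt_or_gt with he | he
      · exact div_pos_of_neg_of_neg
          ((not_lt.1 fun hf => he.not_gt (hef.mpr hf)).lt_of_ne (hc₀ f)) he
      · exact div_pos (hef.mp he) he
    have hray : SameRay ℝ (X.edgeVec Φ e) (X.edgeVec Φ f) := by
      rw [show X.edgeVec Φ f = (c f / c e) • X.edgeVec Φ e by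
        rw [hc e, hc f, smul_smul, div_mul_cancel₀ _ (hc₀ e)]]
      exact SameRay.sameRay_pos_smul_right _ hratio
    exact Subtype.ext (eq_of_sameRay_edgeVec hinj (e.2.trans f.2.symm) hray)
  simpa [degree] using Nat.card_le_card_of_injective _ hsign

end Realization

end DirGraph

/-! ### Symmetries of a realized graph -/

section Symmetry

variable {F : Type*} [NormedAddCommGroup F] [InnerProductSpace ℝ F]

/-- The group of all congruence transformations that map a set onto itself. -/
def symmetryGroup (S : Set F) : Subgroup (F ≃ᵃⁱ[ℝ] F) where
  carrier := {g | g '' S = S}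
  one_mem' := Set.image_id S
  mul_mem' {g h} hg hh := by
    change (g ∘ h) '' S = S
    rw [Set.image_comp, show h '' S = S from hh, show g '' S = S from hg]
  inv_mem' {g} hg := by
    change g.symm '' S = S
    conv_lhs => rw [← show g '' S = S from hg]
    exact g.toEquiv.symm_image_image S

theorem map_mem_of_mem_symmetryGroup {S : Set F} {g : F ≃ᵃⁱ[ℝ] F} (hg : g ∈ symmetryGroup S)
    {p : F} (hp : p ∈ S) : g p ∈ S := by
  rw [← show g '' S = S from hg]
  exact Set.mem_image_of_mem g hp

theorem map_add_linearPart (g : F ≃ᵃⁱ[ℝ] F) (p w : F) : g (p + w) = g p + linearPart g w := by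
  rw [add_comm p, add_comm (g p)]
  exact g.map_vadd p w

theorem linearPart_sub (g : F ≃ᵃⁱ[ℝ] F) (p q : F) : linearPart g (p - q) = g p - g q := by
  rw [eq_sub_iff_add_eq', ← map_add_linearPart, add_sub_cancel]

theorem linearPart_inv_apply (g : F ≃ᵃⁱ[ℝ] F) (w : F) :
    linearPart g⁻¹ (linearPart g w) = w := by
  rw [map_inv]
  exact (linearPart g).symm_apply_apply w

/-- The set `S` contains a short segment that starts at `p` in the direction of `w`. -/
def IsTangent (S : Set F) (p w : F) : Prop := ∀ᶠ s in 𝓝[>] (0 : ℝ), p + s • w ∈ S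

theorem IsTangent.map {S : Set F} {p w : F} (h : IsTangent S p w) {g : F ≃ᵃⁱ[ℝ] F}
    (hg : g ∈ symmetryGroup S) : IsTangent S (g p) (linearPart g w) := by
  filter_upwards [h] with s hs
  rw [← map_smul, ← map_add_linearPart]
  exact map_mem_of_mem_symmetryGroup hg hs

namespace DirGraph

variable {V E : Type*} {X : DirGraph V E} {Φ : V → F}

/-- The image of an edge of the covering graph in the ambient space. -/
def edgeSegment (X : DirGraph V E) (Φ : V → F) (e : E) : Set F := X.edgeLine Φ e '' Set.Icc 0 1

theorem isCompact_edgeSegment (e : E) : IsCompact (X.edgeSegment Φ e) :=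
  isCompact_Icc.image AffineMap.lineMap_continuous

theorem surjective_o_of_three_le_degree (hdeg : ∀ x, 3 ≤ X.degree x) : Function.Surjective X.o := by
  intro x
  have hpos : 0 < X.degree x := by linarith [hdeg x]
  obtain ⟨⟨e, he⟩⟩ := (Nat.card_pos_iff.1 hpos).1
  exact ⟨e, he⟩

theorem isTangent_edgeVec (ho : Function.Surjective X.o) (e : E) :
    IsTangent (Set.range (X.plMap Φ)) (Φ (X.o e)) (X.edgeVec Φ e) := by
  filter_upwards [Ioc_mem_nhdsGT (zero_lt_one' ℝ)] with s hs
  exact (mem_range_plMap_iff ho).2 ⟨e, s, Set.Ioc_subset_Icc_self hs, edgeLine_apply e s⟩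

theorem exists_edge_of_isTangent (ho : Function.Surjective X.o)
    (hlf : LocallyFinite (X.edgeSegment Φ)) {p w : F}
    (h : IsTangent (Set.range (X.plMap Φ)) p w) :
    ∃ e, ∃ s ∈ Set.Icc (0 : ℝ) 1, X.edgeLine Φ e s = p ∧
      ∃ c r : ℝ, 0 < r ∧ s + r * c ∈ Set.Icc (0 : ℝ) 1 ∧ w = c • X.edgeVec Φ e := by
  have hlim : Tendsto (fun s : ℝ => p + s • w) (𝓝[>] 0) (𝓝 p) :=
    tendsto_nhdsWithin_of_tendsto_nhds (Continuous.tendsto' (by fun_prop) _ _ (by simp))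
  obtain ⟨U, hU, hfin⟩ := hlf p
  have hedge : ∃ᶠ s in 𝓝[>] (0 : ℝ), ∃ e ∈ {e | (X.edgeSegment Φ e ∩ U).Nonempty},
      p + s • w ∈ X.edgeSegment Φ e := by
    refine Eventually.frequently ?_
    filter_upwards [h, hlim hU] with s hs hsU
    obtain ⟨e, he⟩ := (mem_range_plMap_iff ho).1 hs
    exact ⟨e, ⟨_, he, hsU⟩, he⟩
  obtain ⟨e, -, hfreq⟩ := hfin.frequently_exists.1 hedge
  obtain ⟨s, hs, hsp⟩ :=
    (isCompact_edgeSegment e).isClosed.mem_of_frequently_of_tendsto hfreq hlim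
  obtain ⟨r, ⟨t, ht, htp⟩, hr⟩ := (hfreq.and_eventually self_mem_nhdsWithin).exists
  have hr : 0 < r := hr
  refine ⟨e, s, hs, hsp, (t - s) / r, r, hr, by rwa [mul_div_cancel₀ _ hr.ne', add_sub_cancel], ?_⟩
  have hdiff : r • w = (t - s) • X.edgeVec Φ e := by
    rw [← add_right_inj p, ← htp, ← hsp]
    simp only [edgeLine_apply]
    module
  rw [div_eq_inv_mul, mul_smul, ← hdiff, inv_smul_smul₀ hr.ne']

section Injective

variable (hinj : Function.Injective (X.plMap Φ)) (hdeg : ∀ x, 3 ≤ X.degree x)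
  (hlf : LocallyFinite (X.edgeSegment Φ))

include hinj

theorem exists_edge_of_isTangent_vertex (ho : Function.Surjective X.o)
    (hlf : LocallyFinite (X.edgeSegment Φ)) {x : V} {w : F} (hw : w ≠ 0)
    (h : IsTangent (Set.range (X.plMap Φ)) (Φ x) w) :
    ∃ e, X.o e = x ∧ ∃ c : ℝ, 0 < c ∧ w = c • X.edgeVec Φ e := by
  obtain ⟨e, s, hs, hsp, c, r, hr, hc, rfl⟩ := exists_edge_of_isTangent ho hlf h
  have hc₀ : c ≠ 0 := fun hc => hw (by rw [hc, zero_smul])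
  rcases eq_of_edgeLine_eq_vertex hinj hs hsp with ⟨rfl, rfl⟩ | ⟨rfl, rfl⟩
  · exact ⟨e, rfl, c, lt_of_le_of_ne (by nlinarith [hc.1]) hc₀.symm, rfl⟩
  · exact ⟨X.inv e, X.o_inv e, -c, neg_pos.2 (lt_of_le_of_ne (by nlinarith [hc.2]) hc₀),
      by rw [edgeVec_inv, neg_smul_neg]⟩

theorem exists_eq_smul_of_isTangent_edgeLine (ho : Function.Surjective X.o)
    (hlf : LocallyFinite (X.edgeSegment Φ)) {e : E} {s : ℝ} (hs : s ∈ Set.Ioo (0 : ℝ) 1) {w : F}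
    (h : IsTangent (Set.range (X.plMap Φ)) (X.edgeLine Φ e s) w) :
    ∃ c : ℝ, w = c • X.edgeVec Φ e := by
  obtain ⟨f, t, ht, htp, c, -, -, -, rfl⟩ := exists_edge_of_isTangent ho hlf h
  rcases eq_or_eq_inv_of_edgeLine_eq hinj hs ht htp.symm with ⟨rfl, -⟩ | ⟨rfl, -⟩
  · exact ⟨c, rfl⟩
  · exact ⟨-c, by rw [edgeVec_inv, neg_smul_neg]⟩

include hdeg hlf

/-- All tangent vectors at an inner point of an edge are parallel, those at a vertex are not. -/
theorem exists_map_vertex_eq {g : F ≃ᵃⁱ[ℝ] F} (hg : g ∈ symmetryGroup (Set.range (X.plMap Φ)))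
    (x : V) : ∃ y, g (Φ x) = Φ y := by
  have ho := surjective_o_of_three_le_degree hdeg
  obtain ⟨e, s, hs, hgx⟩ := (mem_range_plMap_iff ho).1
    (map_mem_of_mem_symmetryGroup hg ⟨Quot.mk _ (Sum.inl x), rfl⟩)
  change _ = g (Φ x) at hgx
  rcases hs.1.eq_or_lt with rfl | hs₀
  · exact ⟨X.o e, by rw [← hgx, edgeLine_zero]⟩
  rcases hs.2.eq_or_lt with rfl | hs₁
  · exact ⟨X.t e, by rw [← hgx, edgeLine_one]⟩
  have hparallel (f) (hf : X.o f = x) :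
      ∃ c : ℝ, X.edgeVec Φ f = c • linearPart g⁻¹ (X.edgeVec Φ e) := by
    have htan := (isTangent_edgeVec (Φ := Φ) ho f).map hg
    rw [hf, ← hgx] at htan
    obtain ⟨c, hc⟩ := exists_eq_smul_of_isTangent_edgeLine hinj ho hlf ⟨hs₀, hs₁⟩ htan
    exact ⟨c, by rw [← map_smul, ← hc, linearPart_inv_apply]⟩
  have := degree_le_two_of_parallel hinj hparallel
  linarith [hdeg x]

theorem one_le_of_linearPart_edgeVec_eq_smul {g : F ≃ᵃⁱ[ℝ] F}
    (hg : g ∈ symmetryGroup (Set.range (X.plMap Φ))) {e f : E} {c : ℝ} (hc : 0 < c)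
    (ho : g (Φ (X.o e)) = Φ (X.o f)) (h : linearPart g (X.edgeVec Φ e) = c • X.edgeVec Φ f) :
    1 ≤ c := by
  by_contra! hlt
  obtain ⟨y, hy⟩ := exists_map_vertex_eq hinj hdeg hlf hg (X.t e)
  have hpt : X.edgeLine Φ f c = Φ y := by
    rw [edgeLine_apply, ← ho, ← h, ← map_add_linearPart, ← hy, edgeVec, add_sub_cancel]
  rcases eq_of_edgeLine_eq_vertex hinj ⟨hc.le, hlt.le⟩ hpt with ⟨h, -⟩ | ⟨h, -⟩ <;> linarith

end Injective

/-- The transformation `g` maps the image of the directed edge `e` to that of `f`. -/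
def MapsEdge (X : DirGraph V E) (Φ : V → F) (g : F ≃ᵃⁱ[ℝ] F) (e f : E) : Prop :=
  g (Φ (X.o e)) = Φ (X.o f) ∧ g (Φ (X.t e)) = Φ (X.t f)

namespace MapsEdge

variable {g h : F ≃ᵃⁱ[ℝ] F} {e f k : E}

theorem linearPart_edgeVec (hef : X.MapsEdge Φ g e f) :
    linearPart g (X.edgeVec Φ e) = X.edgeVec Φ f := by
  rw [edgeVec, linearPart_sub, hef.1, hef.2, edgeVec]

theorem inv (hef : X.MapsEdge Φ g e f) : X.MapsEdge Φ g⁻¹ f e :=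
  ⟨g.symm_apply_eq.2 hef.1.symm, g.symm_apply_eq.2 hef.2.symm⟩

theorem mul (hfk : X.MapsEdge Φ h f k) (hef : X.MapsEdge Φ g e f) : X.MapsEdge Φ (h * g) e k :=
  ⟨(congrArg h hef.1).trans hfk.1, (congrArg h hef.2).trans hfk.2⟩

theorem right_unique (hinj : Function.Injective (X.plMap Φ)) (hf : X.MapsEdge Φ g e f)
    (hk : X.MapsEdge Φ g e k) : f = k :=
  eq_of_sameRay_edgeVec hinj (injective_of_injective_plMap hinj (hf.1.symm.trans hk.1)) <| by
    rw [← hf.linearPart_edgeVec, ← hk.linearPart_edgeVec]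

end MapsEdge

theorem exists_mapsEdge (hinj : Function.Injective (X.plMap Φ)) (hdeg : ∀ x, 3 ≤ X.degree x)
    (hlf : LocallyFinite (X.edgeSegment Φ)) {g : F ≃ᵃⁱ[ℝ] F}
    (hg : g ∈ symmetryGroup (Set.range (X.plMap Φ))) (e : E) : ∃ f, X.MapsEdge Φ g e f := by
  have ho := surjective_o_of_three_le_degree hdeg
  obtain ⟨y, hy⟩ := exists_map_vertex_eq hinj hdeg hlf hg (X.o e)
  have htan := (isTangent_edgeVec (Φ := Φ) ho e).map hg
  rw [hy] at htan
  have hne : linearPart g (X.edgeVec Φ e) ≠ 0 :=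
    (linearPart g).map_ne_zero_iff.2 (edgeVec_ne_zero hinj e)
  obtain ⟨f, rfl, c, hc, hcf⟩ := exists_edge_of_isTangent_vertex hinj ho hlf hne htan
  have hc_ge : 1 ≤ c := one_le_of_linearPart_edgeVec_eq_smul hinj hdeg hlf hg hc hy hcf
  have hc_le : 1 ≤ c⁻¹ := by
    refine one_le_of_linearPart_edgeVec_eq_smul hinj hdeg hlf (inv_mem hg) (inv_pos.2 hc)
      (g.symm_apply_eq.2 hy.symm) ?_
    rw [← linearPart_inv_apply g (X.edgeVec Φ e), hcf, map_smul, inv_smul_smul₀ hc.ne']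
  have hc_one : c = 1 := le_antisymm ((one_le_inv₀ hc).1 hc_le) hc_ge
  rw [hc_one, one_smul, edgeVec, linearPart_sub, hy, edgeVec, sub_left_inj] at hcf
  exact ⟨f, hy, hcf⟩

end DirGraph

end Symmetry

/-! ### Periodic realizations -/

section Crystal

variable {V E V₀ E₀ L : Type*} [AddCommGroup L] [AddAction L V] [AddAction L E] {d : ℕ}
  {X : DirGraph V E} {X₀ : DirGraph V₀ E₀} {pV : V → V₀} {pE : E → E₀}

namespace IsTopologicalCrystal

variable (hX : IsTopologicalCrystal d L X X₀ pV pE)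
include hX

theorem exists_lift {x : V} {e₀ : E₀} (h : X₀.o e₀ = pV x) : ∃ e, X.o e = x ∧ pE e = e₀ :=
  (hX.lift_edge x e₀ h).exists

theorem edge_ext {e f : E} (ho : X.o e = X.o f) (hp : pE e = pE f) : e = f :=
  (hX.lift_edge (X.o f) (pE f) (hX.map_o f)).unique ⟨ho, hp⟩ ⟨rfl, rfl⟩

theorem surjective_edge : Function.Surjective pE := by
  intro e₀
  obtain ⟨x, hx⟩ := hX.surjective (X₀.o e₀)
  obtain ⟨e, -, he⟩ := hX.exists_lift hx.symm
  exact ⟨e, he⟩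

theorem exists_vadd_vertex {x y : V} (h : pV x = pV y) : ∃ σ : L, σ +ᵥ x = y :=
  (hX.simply_transitive x y h).exists

theorem exists_vadd_edge {e f : E} (h : pE e = pE f) : ∃ σ : L, σ +ᵥ e = f := by
  obtain ⟨σ, hσ⟩ := hX.exists_vadd_vertex (x := X.o e) (y := X.o f)
    (by rw [← hX.map_o, ← hX.map_o, h])
  exact ⟨σ, hX.edge_ext (by rw [hX.vadd_o, hσ]) (by rw [hX.map_vadd_edge, h])⟩

theorem exists_eq_comp_of_vadd {M : Type*} [Nonempty M] {f : V → M}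
    (hf : ∀ (σ : L) x, f (σ +ᵥ x) = f x) : ∃ h : V₀ → M, f = h ∘ pV := by
  refine (Function.factorsThrough_iff f).1 fun x y hxy => ?_
  obtain ⟨σ, rfl⟩ := hX.exists_vadd_vertex hxy
  exact (hf σ x).symm

theorem buildingCochain_inv {Φ : V → EuclideanSpace ℝ (Fin d)} {v : E₀ → EuclideanSpace ℝ (Fin d)}
    (hv : IsBuildingCochain X pE Φ v) (e₀ : E₀) : v (X₀.inv e₀) = -v e₀ := by
  obtain ⟨e, rfl⟩ := hX.surjective_edge e₀
  rw [← hX.map_inv, hv, hv, X.o_inv, X.t_inv, neg_sub]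

/-- The covering map, restricted to the edges that start at a vertex. -/
noncomputable def starEquiv (x : V) : {e : E // X.o e = x} ≃ {e₀ : E₀ // X₀.o e₀ = pV x} :=
  Equiv.ofBijective (fun e => ⟨pE e, by rw [hX.map_o, e.2]⟩)
    ⟨fun e f h => Subtype.ext (hX.edge_ext (e.2.trans f.2.symm) (congrArg Subtype.val h)),
      fun e₀ => let ⟨e, he, hp⟩ := hX.exists_lift e₀.2; ⟨⟨e, he⟩, Subtype.ext hp⟩⟩

end IsTopologicalCrystal

namespace IsPeriodicRealization

variable {Φ : V → EuclideanSpace ℝ (Fin d)} {ρ : L →+ EuclideanSpace ℝ (Fin d)}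
  (hΦ : IsPeriodicRealization Φ ρ) (hX : IsTopologicalCrystal d L X X₀ pV pE)
include hΦ hX

theorem edgeVec_vadd (σ : L) (e : E) : X.edgeVec Φ (σ +ᵥ e) = X.edgeVec Φ e := by
  simp only [edgeVec, hX.vadd_o, hX.vadd_t, hΦ.equivariant, add_sub_add_right_eq_sub]

theorem edgeLine_vadd (σ : L) (e : E) (s : ℝ) :
    X.edgeLine Φ (σ +ᵥ e) s = ρ σ + X.edgeLine Φ e s := by
  rw [edgeLine_apply, edgeLine_apply, hΦ.edgeVec_vadd hX, hX.vadd_o, hΦ.equivariant,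
    add_comm (Φ _), add_assoc]

theorem exists_isBuildingCochain :
    ∃ v : E₀ → EuclideanSpace ℝ (Fin d), IsBuildingCochain X pE Φ v := by
  refine ⟨fun e₀ => X.edgeVec Φ (Function.surjInv hX.surjective_edge e₀), fun e => ?_⟩
  obtain ⟨σ, hσ⟩ := hX.exists_vadd_edge (Function.surjInv_eq hX.surjective_edge (pE e))
  conv_rhs => rw [← edgeVec, ← hσ]
  exact (hΦ.edgeVec_vadd hX σ _).symm

theorem locallyFinite_edgeSegment : LocallyFinite (X.edgeSegment Φ) := by
  intro p
  refine ⟨Metric.closedBall p 1, Metric.closedBall_mem_nhds p one_pos, ?_⟩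
  have := hX.finite_edges
  let l : E₀ → E := Function.surjInv hX.surjective_edge
  have hproper : Tendsto ρ cofinite (cocompact _) :=
    ρ.tendsto_coe_cofinite_of_discrete hΦ.injective
      (isDiscrete_iff_discreteTopology.2 hΦ.discrete)
  have hfin (e₀ : E₀) : (ρ ⁻¹' (Metric.closedBall p 1 - X.edgeSegment Φ (l e₀))).Finite := by
    have hK : IsCompact (Metric.closedBall p 1 - X.edgeSegment Φ (l e₀)) := by
      rw [sub_eq_add_neg]
      exact (isCompact_closedBall p 1).add (isCompact_edgeSegment (l e₀)).neg
    simpa using mem_cofinite.1 (hproper hK.compl_mem_cocompact)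
  refine (Set.finite_iUnion fun e₀ => (hfin e₀).image (· +ᵥ l e₀)).subset ?_
  rintro e ⟨-, ⟨s, hs, rfl⟩, hball⟩
  obtain ⟨σ, hσ⟩ := hX.exists_vadd_edge (Function.surjInv_eq hX.surjective_edge (pE e))
  refine Set.mem_iUnion.2 ⟨pE e, σ, ⟨_, hball, _, ⟨s, hs, rfl⟩, ?_⟩, hσ⟩
  rw [sub_eq_iff_eq_add, ← hΦ.edgeLine_vadd hX, hσ]

theorem constVAdd_mem_symmetryGroup (ho : Function.Surjective X.o) (σ : L) :
    AffineIsometryEquiv.constVAdd ℝ (EuclideanSpace ℝ (Fin d)) (ρ σ) ∈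
      symmetryGroup (Set.range (X.plMap Φ)) := by
  have hmaps (τ : L) {p} (hp : p ∈ Set.range (X.plMap Φ)) :
      ρ τ + p ∈ Set.range (X.plMap Φ) := by
    obtain ⟨e, s, hs, rfl⟩ := (mem_range_plMap_iff ho).1 hp
    exact (mem_range_plMap_iff ho).2 ⟨τ +ᵥ e, s, hs, hΦ.edgeLine_vadd hX τ e s⟩
  refine Set.Subset.antisymm (Set.image_subset_iff.2 fun p hp => hmaps σ hp) fun p hp => ?_
  refine ⟨_, hmaps (-σ) hp, ?_⟩
  change ρ σ + (ρ (-σ) + p) = p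
  rw [map_neg, add_neg_cancel_left]

theorem mapsEdge_constVAdd (σ : L) (e : E) :
    X.MapsEdge Φ (AffineIsometryEquiv.constVAdd ℝ _ (ρ σ)) e (σ +ᵥ e) := by
  constructor
  · rw [hX.vadd_o, hΦ.equivariant]; exact add_comm _ _
  · rw [hX.vadd_t, hΦ.equivariant]; exact add_comm _ _

end IsPeriodicRealization

end Crystal

section Harmonic

theorem linearPart_sum_edgeVec {V E F : Type*} [NormedAddCommGroup F] [InnerProductSpace ℝ F]
    {X : DirGraph V E} {Φ : V → F} (hinj : Function.Injective (X.plMap Φ))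
    (hdeg : ∀ x, 3 ≤ X.degree x) (hlf : LocallyFinite (X.edgeSegment Φ)) {x : V}
    [Fintype {e // X.o e = x}] {g : F ≃ᵃⁱ[ℝ] F}
    (hg : g ∈ symmetryGroup (Set.range (X.plMap Φ))) (hgx : g (Φ x) = Φ x) :
    linearPart g (∑ e : {e // X.o e = x}, X.edgeVec Φ e) =
      ∑ e : {e // X.o e = x}, X.edgeVec Φ e := by
  choose γ hγ using exists_mapsEdge hinj hdeg hlf hg
  have ho (e : {e // X.o e = x}) : X.o (γ e) = x :=
    injective_of_injective_plMap hinj (by rw [← (hγ e).1, e.2, hgx])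
  let π : {e // X.o e = x} → {e // X.o e = x} := fun e => ⟨γ e, ho e⟩
  have hπ : Function.Injective π := by
    intro e f hef
    have hef : γ e = γ f := congrArg Subtype.val hef
    exact Subtype.ext ((hγ e).inv.right_unique hinj (hef ▸ (hγ f).inv))
  calc linearPart g (∑ e : {e // X.o e = x}, X.edgeVec Φ e)
      = ∑ e, X.edgeVec Φ (π e) := by
        rw [map_sum]
        exact Finset.sum_congr rfl fun e _ => (hγ e).linearPart_edgeVec
    _ = ∑ e : {e // X.o e = x}, X.edgeVec Φ e :=
      (Finite.injective_iff_bijective.1 hπ).sum_comp fun e => X.edgeVec Φ e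

theorem isHarmonic_of_forall_linearPart_eq {V E V₀ E₀ L : Type*} [Fintype E₀] [AddCommGroup L]
    [AddAction L V] [AddAction L E] {d : ℕ} {X : DirGraph V E} {X₀ : DirGraph V₀ E₀} {pV : V → V₀}
    {pE : E → E₀} (hX : IsTopologicalCrystal d L X X₀ pV pE) (hdeg : ∀ x, 3 ≤ X.degree x)
    {Φ : V → EuclideanSpace ℝ (Fin d)} (hinj : Function.Injective (X.plMap Φ))
    (hlf : LocallyFinite (X.edgeSegment Φ)) {v : E₀ → EuclideanSpace ℝ (Fin d)}
    (hv : IsBuildingCochain X pE Φ v)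
    (hfix : ∀ x w, (∀ g ∈ isotropyGroup (symmetryGroup (Set.range (X.plMap Φ))) (Φ x),
      linearPart g w = w) → w = 0) :
    IsHarmonic X₀ v := by
  classical
  intro x₀
  obtain ⟨x, rfl⟩ := hX.surjective x₀
  have : Fintype {e // X.o e = x} := Fintype.ofEquiv _ (hX.starEquiv x).symm
  calc ∑ e₀ with X₀.o e₀ = pV x, v e₀
      = ∑ e₀ : {e₀ // X₀.o e₀ = pV x}, v e₀ := by rw [← Finset.sum_subtype_eq_sum_filter]; simp
    _ = ∑ e : {e // X.o e = x}, X.edgeVec Φ e :=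
      ((hX.starEquiv x).sum_comp fun e₀ => v e₀).symm.trans (Finset.sum_congr rfl fun e _ => hv e)
    _ = 0 := hfix x _ fun g hg => linearPart_sum_edgeVec hinj hdeg hlf hg.1 hg.2

end Harmonic

/-! ### Tight frames -/

section Frame

variable {I F : Type*} [Fintype I] [NormedAddCommGroup F] [InnerProductSpace ℝ F]

/-- The frame operator `x ↦ ∑ᵢ ⟨x, vᵢ⟩ vᵢ` of a finite family of vectors. -/
noncomputable def frameOperator (v : I → F) : F →ₗ[ℝ] F :=
  ∑ i, (innerₛₗ ℝ (v i)).smulRight (v i)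

theorem frameOperator_apply (v : I → F) (x : F) :
    frameOperator v x = ∑ i, inner ℝ x (v i) • v i := by
  simp [frameOperator, LinearMap.sum_apply, real_inner_comm]

theorem inner_frameOperator (v : I → F) (x y : F) :
    inner ℝ (frameOperator v x) y = ∑ i, inner ℝ x (v i) * inner ℝ y (v i) := by
  rw [frameOperator_apply, sum_inner]
  exact Finset.sum_congr rfl fun i _ => by rw [real_inner_smul_left, real_inner_comm y]

theorem isSymmetric_frameOperator (v : I → F) : (frameOperator v).IsSymmetric := fun x y => by
  rw [inner_frameOperator, real_inner_comm, inner_frameOperator]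
  exact Finset.sum_congr rfl fun i _ => mul_comm _ _

theorem mem_orthogonal_span_iff {s : Set F} {x : F} :
    x ∈ (Submodule.span ℝ s)ᗮ ↔ ∀ u ∈ s, inner ℝ x u = 0 := by
  rw [← Submodule.span_singleton_le_iff_mem, ← Submodule.isOrtho_iff_le, Submodule.isOrtho_span]
  simp only [Set.mem_singleton_iff, forall_eq]

theorem inner_frameOperator_self_pos {v : I → F} (hv : Submodule.span ℝ (Set.range v) = ⊤) {x : F}
    (hx : x ≠ 0) : 0 < inner ℝ (frameOperator v x) x := by
  rw [inner_frameOperator]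
  refine (Finset.sum_nonneg fun i _ => mul_self_nonneg _).lt_of_ne' fun h => hx ?_
  have horth (i) : inner ℝ x (v i) = 0 :=
    mul_self_eq_zero.1 ((Finset.sum_eq_zero_iff_of_nonneg fun i _ => mul_self_nonneg _).1 h i
      (Finset.mem_univ i))
  have hmem : x ∈ (Submodule.span ℝ (Set.range v))ᗮ :=
    mem_orthogonal_span_iff.2 (Set.forall_mem_range.2 horth)
  rwa [hv, Submodule.top_orthogonal_eq_bot, Submodule.mem_bot] at hmem

theorem ActsIrreducibly.exists_eq_smul_of_isSymmetric [FiniteDimensional ℝ F]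
    {K : Subgroup (F ≃ₗᵢ[ℝ] F)} (hK : ActsIrreducibly K) {T : F →ₗ[ℝ] F} (hT : T.IsSymmetric)
    (hcomm : ∀ g ∈ K, ∀ x, T (g x) = g (T x)) : ∃ α : ℝ, ∀ x, T x = α • x := by
  obtain ⟨hnontrivial, hirr⟩ := hK
  obtain ⟨α, hα⟩ : ∃ α : ℝ, Module.End.HasEigenvalue T α :=
    ⟨_, hT.hasEigenvalue_iSup_of_finiteDimensional⟩
  have htop : Module.End.eigenspace T α = ⊤ := by
    refine (hirr _ fun g hg w hw => ?_).resolve_left hα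
    rw [Module.End.mem_eigenspace_iff] at hw ⊢
    rw [hcomm g hg, hw, map_smul]
  exact ⟨α, fun x => Module.End.mem_eigenspace_iff.1 (htop ▸ Submodule.mem_top)⟩

theorem isTightFrame_of_actsIrreducibly {d : ℕ} {v : I → EuclideanSpace ℝ (Fin d)}
    (hspan : Submodule.span ℝ (Set.range v) = ⊤)
    {K : Subgroup (EuclideanSpace ℝ (Fin d) ≃ₗᵢ[ℝ] EuclideanSpace ℝ (Fin d))}
    (hK : ActsIrreducibly K)
    (hcomm : ∀ g ∈ K, ∀ x, frameOperator v (g x) = g (frameOperator v x)) : IsTightFrame v := by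
  obtain ⟨α, hα⟩ := hK.exists_eq_smul_of_isSymmetric (isSymmetric_frameOperator v) hcomm
  have := hK.1
  obtain ⟨x, hx⟩ := exists_ne (0 : EuclideanSpace ℝ (Fin d))
  have hpos := inner_frameOperator_self_pos hspan hx
  rw [hα, real_inner_smul_left] at hpos
  exact ⟨hspan, α, pos_of_mul_pos_left hpos real_inner_self_nonneg,
    fun x => by rw [← frameOperator_apply, hα]⟩

end Frame

section Counting

theorem card_range_eq_index {G β : Type*} [AddGroup G] {H : AddSubgroup G} {f : G → β}
    (hf : ∀ a b, f a = f b ↔ -a + b ∈ H) : Nat.card (Set.range f) = H.index :=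
  Nat.card_congr ((Setoid.quotientKerEquivRange f).symm.trans
    (Quotient.congrRight fun a b => (hf a b).trans QuotientAddGroup.leftRel_apply.symm))

theorem sum_eq_sum_of_biregular {ι κ M : Type*} [Fintype ι] [Fintype κ] [AddCommMonoid M]
    [IsAddTorsionFree M] {R : ι → κ → Prop} {k : ℕ} (hk : k ≠ 0)
    (hl : ∀ a, Nat.card {b | R a b} = k) (hr : ∀ b, Nat.card {a | R a b} = k) {p : ι → M}
    {q : κ → M} (hpq : ∀ a b, R a b → p a = q b) : ∑ a, p a = ∑ b, q b := by
  classical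
  refine IsAddTorsionFree.nsmul_right_injective hk ?_
  calc k • ∑ a, p a = ∑ a, ∑ b with R a b, p a := by
        simp only [Finset.smul_sum, Finset.sum_const, ← Fintype.card_subtype,
          ← Nat.card_eq_fintype_card]
        exact Finset.sum_congr rfl fun a _ => by rw [← hl a]; rfl
    _ = ∑ b, ∑ a with R a b, p a := Finset.sum_sum_bipartiteAbove_eq_sum_sum_bipartiteBelow R _
    _ = ∑ b, ∑ a with R a b, q b :=
        Finset.sum_congr rfl fun b _ => Finset.sum_congr rfl fun a ha =>
          hpq a b (Finset.mem_filter.1 ha).2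
    _ = k • ∑ b, q b := by
        simp only [Finset.smul_sum, Finset.sum_const, ← Fintype.card_subtype,
          ← Nat.card_eq_fintype_card]
        exact Finset.sum_congr rfl fun b _ => by rw [← hr b]; rfl

end Counting

section Invariance

theorem eq_constVAdd_of_linearPart_eq_one {F : Type*} [NormedAddCommGroup F]
    [InnerProductSpace ℝ F] {g : F ≃ᵃⁱ[ℝ] F} (hg : linearPart g = 1) :
    g = AffineIsometryEquiv.constVAdd ℝ F (g 0) := by
  ext p
  have h := map_add_linearPart g 0 p
  rwa [zero_add, hg] at h

variable {V E V₀ E₀ L : Type*} [AddCommGroup L] [AddAction L V] {d : ℕ}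
  {X : DirGraph V E} {X₀ : DirGraph V₀ E₀} {pV : V → V₀} {pE : E → E₀}
  {Φ : V → EuclideanSpace ℝ (Fin d)} {ρ : L →+ EuclideanSpace ℝ (Fin d)}
  {v : E₀ → EuclideanSpace ℝ (Fin d)}

theorem span_range_buildingCochain (hX : X.Connected) (hΦ : IsPeriodicRealization Φ ρ)
    (hv : IsBuildingCochain X pE Φ v) : Submodule.span ℝ (Set.range v) = ⊤ := by
  have hpath (x y : V) : Φ y - Φ x ∈ Submodule.span ℝ (Set.range v) := by
    induction hX.2 x y with
    | refl => rw [sub_self]; exact zero_mem _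
    | tail _ h ih =>
      obtain ⟨e, rfl, rfl⟩ := h
      have hedge : Φ (X.t e) - Φ (X.o e) ∈ Submodule.span ℝ (Set.range v) :=
        hv e ▸ Submodule.subset_span (Set.mem_range_self _)
      simpa only [sub_add_sub_cancel] using add_mem hedge ih
  rw [← top_le_iff, ← hΦ.span_eq_top, Submodule.span_le]
  rintro _ ⟨σ, rfl⟩
  obtain ⟨x⟩ := hX.1
  simpa only [SetLike.mem_coe, hΦ.equivariant, add_sub_cancel_left] using hpath x (σ +ᵥ x)

/-- The edges `a` and `b` of the base graph have lifts that correspond under a symmetry, with linear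
part `γ`, of the realized graph. -/
def EdgesCorrespond (X : DirGraph V E) (pE : E → E₀) (Φ : V → EuclideanSpace ℝ (Fin d))
    (γ : EuclideanSpace ℝ (Fin d) ≃ₗᵢ[ℝ] EuclideanSpace ℝ (Fin d)) (a b : E₀) : Prop :=
  ∃ g ∈ symmetryGroup (Set.range (X.plMap Φ)), linearPart g = γ ∧
    ∃ e f, pE e = a ∧ pE f = b ∧ X.MapsEdge Φ g e f

theorem EdgesCorrespond.inv {γ : EuclideanSpace ℝ (Fin d) ≃ₗᵢ[ℝ] EuclideanSpace ℝ (Fin d)}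
    {a b : E₀} (h : EdgesCorrespond X pE Φ γ a b) : EdgesCorrespond X pE Φ γ⁻¹ b a :=
  let ⟨g, hg, hγ, e, f, he, hf, hef⟩ := h
  ⟨g⁻¹, inv_mem hg, by rw [map_inv, hγ], f, e, hf, he, hef.inv⟩

theorem edgesCorrespond_inv_iff {γ : EuclideanSpace ℝ (Fin d) ≃ₗᵢ[ℝ] EuclideanSpace ℝ (Fin d)}
    {a b : E₀} : EdgesCorrespond X pE Φ γ⁻¹ b a ↔ EdgesCorrespond X pE Φ γ a b :=
  ⟨fun h => inv_inv γ ▸ h.inv, .inv⟩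

theorem EdgesCorrespond.apply_eq (hv : IsBuildingCochain X pE Φ v)
    {γ : EuclideanSpace ℝ (Fin d) ≃ₗᵢ[ℝ] EuclideanSpace ℝ (Fin d)} {a b : E₀}
    (h : EdgesCorrespond X pE Φ γ a b) : γ (v a) = v b := by
  obtain ⟨g, -, rfl, e, f, rfl, rfl, hef⟩ := h
  rw [hv e, hv f]
  exact hef.linearPart_edgeVec

variable [AddAction L E] (hX : IsTopologicalCrystal d L X X₀ pV pE)
  (hΦ : IsPeriodicRealization Φ ρ) (hinj : Function.Injective (X.plMap Φ))
  (hdeg : ∀ x, 3 ≤ X.degree x)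
include hX hΦ

theorem edgesCorrespond_proj_left_iff (ho : Function.Surjective X.o)
    {γ : EuclideanSpace ℝ (Fin d) ≃ₗᵢ[ℝ] EuclideanSpace ℝ (Fin d)} {e : E} {b : E₀} :
    EdgesCorrespond X pE Φ γ (pE e) b ↔
      ∃ g ∈ symmetryGroup (Set.range (X.plMap Φ)), linearPart g = γ ∧
        ∃ f, pE f = b ∧ X.MapsEdge Φ g e f := by
  constructor
  · rintro ⟨g, hg, hγ, e', f, he, hf, hef⟩
    obtain ⟨σ, rfl⟩ := hX.exists_vadd_edge he.symm
    refine ⟨_, mul_mem hg (hΦ.constVAdd_mem_symmetryGroup hX ho σ), ?_, f, hf,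
      hef.mul (hΦ.mapsEdge_constVAdd hX σ e)⟩
    rw [map_mul, hγ]
    exact mul_one γ
  · rintro ⟨g, hg, hγ, f, hf, hef⟩
    exact ⟨g, hg, hγ, e, f, rfl, hf, hef⟩

theorem proj_eq_proj_iff_of_mapsEdge_constVAdd (hinj : Function.Injective (X.plMap Φ))
    {τ υ : EuclideanSpace ℝ (Fin d)} {e f k : E}
    (hτ : X.MapsEdge Φ (AffineIsometryEquiv.constVAdd ℝ _ τ) e f)
    (hυ : X.MapsEdge Φ (AffineIsometryEquiv.constVAdd ℝ _ υ) e k) :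
    pE f = pE k ↔ -τ + υ ∈ ρ.range := by
  constructor
  · intro h
    obtain ⟨σ, rfl⟩ := hX.exists_vadd_edge h
    refine ⟨σ, ?_⟩
    have horigin : υ + Φ (X.o e) = τ + Φ (X.o e) + ρ σ := by
      rw [show υ + Φ (X.o e) = _ from hυ.1, show τ + Φ (X.o e) = _ from hτ.1, hX.vadd_o,
        hΦ.equivariant]
    rw [add_right_comm, add_left_inj] at horigin
    rw [horigin, neg_add_cancel_left]
  · rintro ⟨σ, hσ⟩
    have hmul : AffineIsometryEquiv.constVAdd ℝ (EuclideanSpace ℝ (Fin d)) (ρ σ) *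
        AffineIsometryEquiv.constVAdd ℝ _ τ = AffineIsometryEquiv.constVAdd ℝ _ υ := by
      ext1 p
      change ρ σ + (τ + p) = υ + p
      rw [hσ, ← add_assoc, neg_add_eq_sub, sub_add_cancel]
    have hστ := (hΦ.mapsEdge_constVAdd hX σ f).mul hτ
    rw [hmul] at hστ
    rw [← hστ.right_unique hinj hυ, hX.map_vadd_edge]

include hinj hdeg

theorem card_setOf_edgesCorrespond_one (a : E₀) :
    Nat.card {b | EdgesCorrespond X pE Φ 1 a b} =
      ρ.range.relIndex
        (AddAction.stabilizer (EuclideanSpace ℝ (Fin d)) (Set.range (X.plMap Φ))) := by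
  obtain ⟨e, rfl⟩ := hX.surjective_edge a
  have ho := surjective_o_of_three_le_degree hdeg
  choose f hf using fun τ : AddAction.stabilizer (EuclideanSpace ℝ (Fin d))
    (Set.range (X.plMap Φ)) =>
      exists_mapsEdge hinj hdeg (hΦ.locallyFinite_edgeSegment hX)
        (g := AffineIsometryEquiv.constVAdd ℝ _ (τ : EuclideanSpace ℝ (Fin d))) τ.2 e
  have hrange : {b | EdgesCorrespond X pE Φ 1 (pE e) b} = Set.range fun τ => pE (f τ) := by
    ext b
    constructor
    · intro hb
      obtain ⟨g, hg, hγ, k, rfl, hk⟩ := (edgesCorrespond_proj_left_iff hX hΦ ho).1 hb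
      rw [eq_constVAdd_of_linearPart_eq_one hγ] at hg hk
      exact ⟨⟨g 0, hg⟩, congrArg pE ((hf _).right_unique hinj hk)⟩
    · rintro ⟨τ, rfl⟩
      exact ⟨_, τ.2, rfl, e, f τ, rfl, rfl, hf τ⟩
  rw [hrange]
  exact card_range_eq_index fun τ υ =>
    proj_eq_proj_iff_of_mapsEdge_constVAdd hX hΦ hinj (hf τ) (hf υ)

theorem card_setOf_edgesCorrespond {g : EuclideanSpace ℝ (Fin d) ≃ᵃⁱ[ℝ] EuclideanSpace ℝ (Fin d)}
    (hg : g ∈ symmetryGroup (Set.range (X.plMap Φ))) (a : E₀) :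
    Nat.card {b | EdgesCorrespond X pE Φ (linearPart g) a b} =
      ρ.range.relIndex
        (AddAction.stabilizer (EuclideanSpace ℝ (Fin d)) (Set.range (X.plMap Φ))) := by
  obtain ⟨e, rfl⟩ := hX.surjective_edge a
  have ho := surjective_o_of_three_le_degree hdeg
  obtain ⟨f, hef⟩ := exists_mapsEdge hinj hdeg (hΦ.locallyFinite_edgeSegment hX) hg e
  rw [← card_setOf_edgesCorrespond_one hX hΦ hinj hdeg (pE f)]
  refine congrArg (fun s : Set E₀ => Nat.card s) (Set.ext fun b => ?_)
  change EdgesCorrespond _ _ _ _ _ _ ↔ EdgesCorrespond _ _ _ _ _ _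
  rw [edgesCorrespond_proj_left_iff hX hΦ ho, edgesCorrespond_proj_left_iff hX hΦ ho]
  constructor
  · rintro ⟨h, hh, hγ, k, hk, hek⟩
    exact ⟨h * g⁻¹, mul_mem hh (inv_mem hg), by rw [map_mul, map_inv, hγ, mul_inv_cancel], k, hk,
      hek.mul hef.inv⟩
  · rintro ⟨h, hh, hγ, k, hk, hfk⟩
    exact ⟨h * g, mul_mem hh hg, by rw [map_mul, hγ, one_mul], k, hk, hfk.mul hef⟩

theorem sum_comp_linearPart_buildingCochain [Fintype E₀] (hv : IsBuildingCochain X pE Φ v)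
    {g : EuclideanSpace ℝ (Fin d) ≃ᵃⁱ[ℝ] EuclideanSpace ℝ (Fin d)}
    (hg : g ∈ symmetryGroup (Set.range (X.plMap Φ))) {M : Type*} [AddCommMonoid M]
    [IsAddTorsionFree M] (q : EuclideanSpace ℝ (Fin d) → M) :
    ∑ a, q (linearPart g (v a)) = ∑ a, q (v a) := by
  rcases isEmpty_or_nonempty E₀ with hE | ⟨⟨a⟩⟩
  · simp
  have hindex : ρ.range.relIndex
      (AddAction.stabilizer (EuclideanSpace ℝ (Fin d)) (Set.range (X.plMap Φ))) ≠ 0 := by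
    obtain ⟨e, rfl⟩ := hX.surjective_edge a
    rw [← card_setOf_edgesCorrespond_one hX hΦ hinj hdeg (pE e)]
    have : Nonempty {b | EdgesCorrespond X pE Φ 1 (pE e) b} :=
      ⟨pE e, 1, one_mem _, map_one _, e, e, rfl, rfl, rfl, rfl⟩
    exact Nat.card_pos.ne'
  refine sum_eq_sum_of_biregular hindex (card_setOf_edgesCorrespond hX hΦ hinj hdeg hg)
    (fun b => ?_) fun a b hab => congrArg q (hab.apply_eq hv)
  rw [← card_setOf_edgesCorrespond hX hΦ hinj hdeg (inv_mem hg) b]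
  simp only [map_inv, edgesCorrespond_inv_iff]

theorem frameOperator_linearPart_comm [Fintype E₀] (hv : IsBuildingCochain X pE Φ v)
    {g : EuclideanSpace ℝ (Fin d) ≃ᵃⁱ[ℝ] EuclideanSpace ℝ (Fin d)}
    (hg : g ∈ symmetryGroup (Set.range (X.plMap Φ))) (x : EuclideanSpace ℝ (Fin d)) :
    frameOperator v (linearPart g x) = linearPart g (frameOperator v x) := by
  have : IsAddTorsionFree (EuclideanSpace ℝ (Fin d)) := .of_isTorsionFree ℝ _
  rw [frameOperator_apply, frameOperator_apply, map_sum,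
    ← sum_comp_linearPart_buildingCochain hX hΦ hinj hdeg hv hg
      fun w => inner ℝ (linearPart g x) w • w]
  simp only [LinearIsometryEquiv.inner_map_map, map_smul]

end Invariance

/-! ### Chains and potentials -/

namespace DirGraph

variable {V E K M : Type*} [CommRing K] [AddCommGroup M] {X : DirGraph V E}

theorem mem_chains_iff_mapDomain_inv {z : E →₀ K} :
    z ∈ X.chains K ↔ Finsupp.mapDomain X.inv z = -z := by
  have hinv : Function.Injective X.inv := Function.LeftInverse.injective X.inv_inv
  constructor
  · intro hz
    ext e
    rw [← X.inv_inv e, Finsupp.mapDomain_apply hinv, X.inv_inv, Finsupp.neg_apply]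
    exact hz e
  · intro hz e
    have h := DFunLike.congr_fun hz (X.inv e)
    rw [Finsupp.mapDomain_apply hinv, Finsupp.neg_apply] at h
    rw [h, neg_neg]

theorem mapDomain_mem_chains {V₀ E₀ : Type*} {X₀ : DirGraph V₀ E₀} {p : E → E₀}
    (hp : ∀ e, p (X.inv e) = X₀.inv (p e)) {z : E →₀ K} (hz : z ∈ X.chains K) :
    Finsupp.mapDomain p z ∈ X₀.chains K := by
  have hcomp : X₀.inv ∘ p = p ∘ X.inv := funext fun e => (hp e).symm
  rw [mem_chains_iff_mapDomain_inv, ← Finsupp.mapDomain_comp, hcomp, Finsupp.mapDomain_comp,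
    mem_chains_iff_mapDomain_inv.1 hz]
  exact map_neg (Finsupp.mapDomain.addMonoidHom p) z

theorem mapDomain_t_eq_zero {z : X.chains K} (hz : z ∈ X.H1 K) : Finsupp.mapDomain X.t z.1 = 0 :=
  hz

theorem mapDomain_o_eq_zero {z : X.chains K} (hz : z ∈ X.H1 K) :
    Finsupp.mapDomain X.o z.1 = 0 := by
  have hcomp : X.o = X.t ∘ X.inv := funext fun e => (X.t_inv e).symm
  rw [hcomp, Finsupp.mapDomain_comp, mem_chains_iff_mapDomain_inv.1 z.2]
  exact (map_neg (Finsupp.mapDomain.addMonoidHom X.t) z.1).trans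
    (neg_eq_zero.2 (mapDomain_t_eq_zero hz))

theorem linearCombination_coboundary [Module K M] (h : V → M) {z : X.chains K} (hz : z ∈ X.H1 K) :
    Finsupp.linearCombination K (fun e => h (X.t e) - h (X.o e)) z.1 = 0 := by
  calc Finsupp.linearCombination K (fun e => h (X.t e) - h (X.o e)) z.1
      = Finsupp.linearCombination K (h ∘ X.t) z.1 - Finsupp.linearCombination K (h ∘ X.o) z.1 := by
        simp only [Finsupp.linearCombination_apply, Finsupp.sum, ← Finset.sum_sub_distrib,
          smul_sub, Function.comp_apply]
    _ = Finsupp.linearCombination K h (Finsupp.mapDomain X.t z.1) -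
          Finsupp.linearCombination K h (Finsupp.mapDomain X.o z.1) := by
        rw [Finsupp.linearCombination_mapDomain, Finsupp.linearCombination_mapDomain]
    _ = 0 := by rw [mapDomain_t_eq_zero hz, mapDomain_o_eq_zero hz, sub_self]

theorem Connected.exists_chain_boundary_eq (hX : X.Connected) (K : Type*) [CommRing K] (x y : V) :
    ∃ z : X.chains K, X.boundary K z = Finsupp.single y 1 - Finsupp.single x 1 := by
  induction hX.2 x y with
  | refl => exact ⟨0, by rw [map_zero, sub_self]⟩
  | tail _ h ih =>
    obtain ⟨e, rfl, rfl⟩ := h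
    obtain ⟨z, hz⟩ := ih
    exact ⟨z + X.edgeChain K e, by rw [map_add, hz, boundary_edgeChain]; abel⟩

theorem Connected.exists_eq_coboundary [Module ℚ M] (hX : X.Connected) {c : E → M}
    (hc : ∀ e, c (X.inv e) = -c e) (hH1 : ∀ z ∈ X.H1 ℤ, Finsupp.linearCombination ℤ c z.1 = 0) :
    ∃ f : V → M, ∀ e, f (X.t e) - f (X.o e) = c e := by
  let J := (Finsupp.linearCombination ℤ c).comp (X.chains ℤ).subtype
  obtain ⟨x₀⟩ := hX.1
  choose z hz using hX.exists_chain_boundary_eq ℤ x₀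
  refine ⟨fun x => (2⁻¹ : ℚ) • J (z x), fun e => ?_⟩
  have hcycle : z (X.t e) - z (X.o e) - X.edgeChain ℤ e ∈ X.H1 ℤ := by
    rw [H1, LinearMap.mem_ker, map_sub, map_sub, hz, hz, boundary_edgeChain]
    abel
  -- The chain of `e` has coefficient `-1` at `inv e`, hence the factor two.
  have hJe : J (X.edgeChain ℤ e) = (2 : ℚ) • c e := by
    simp only [J, edgeChain, LinearMap.comp_apply, Submodule.subtype_apply, map_sub,
      Finsupp.linearCombination_single, one_smul, hc, sub_neg_eq_add, two_smul]
  have hJ : J (z (X.t e)) - J (z (X.o e)) - J (X.edgeChain ℤ e) = 0 := by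
    rw [← map_sub, ← map_sub]
    exact hH1 _ hcycle
  rw [← smul_sub, sub_eq_zero.1 hJ, hJe, inv_smul_smul₀ two_ne_zero]

theorem Connected.exists_addMonoidHom_of_vadd {L : Type*} [AddMonoid L] [AddAction L V]
    (hX : X.Connected) {f : V → M}
    (hf : ∀ (σ : L) e, f (σ +ᵥ X.t e) - f (σ +ᵥ X.o e) = f (X.t e) - f (X.o e)) :
    ∃ χ : L →+ M, ∀ σ x, f (σ +ᵥ x) = f x + χ σ := by
  obtain ⟨x₀⟩ := hX.1
  have hconst (σ : L) (x : V) : f (σ +ᵥ x) - f x = f (σ +ᵥ x₀) - f x₀ := by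
    induction hX.2 x₀ x with
    | refl => rfl
    | tail _ h ih =>
      obtain ⟨e, rfl, rfl⟩ := h
      rw [← ih, sub_eq_sub_iff_sub_eq_sub, hf]
  refine ⟨⟨⟨fun σ => f (σ +ᵥ x₀) - f x₀, by rw [zero_vadd, sub_self]⟩, fun σ τ => ?_⟩,
    fun σ x => sub_eq_iff_eq_add'.1 (hconst σ x)⟩
  change f ((σ + τ) +ᵥ x₀) - f x₀ = f (σ +ᵥ x₀) - f x₀ + (f (τ +ᵥ x₀) - f x₀)
  rw [add_vadd, ← hconst σ (τ +ᵥ x₀), sub_add_sub_cancel]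

theorem eq_zero_of_mem_H1_of_eq_coboundary {c : X.chains ℝ} (hc : c ∈ X.H1 ℝ) {h : V → ℝ}
    (hh : ∀ e, h (X.t e) - h (X.o e) = c.1 e) : c = 0 := by
  have hsum : ∑ e ∈ c.1.support, c.1 e * c.1 e = 0 := by
    simpa only [Finsupp.linearCombination_apply, Finsupp.sum, hh, smul_eq_mul] using
      linearCombination_coboundary h hc
  rw [Finset.sum_eq_zero_iff_of_nonneg fun _ _ => mul_self_nonneg _] at hsum
  refine Subtype.ext (Finsupp.support_eq_empty.1 (Finset.eq_empty_of_forall_notMem fun e he => ?_))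
  exact Finsupp.mem_support_iff.1 he (mul_self_eq_zero.1 (hsum e he))

/-- An odd function on the directed edges of a finite graph, as a 1-chain. -/
noncomputable def chainOfOdd [Finite E] (c : E → K) (hc : ∀ e, c (X.inv e) = -c e) : X.chains K :=
  ⟨Finsupp.equivFunOnFinite.symm c, hc⟩

section Fintype

variable [Fintype E]

theorem inner_chains (a b : X.chains ℝ) : inner ℝ a b = 1 / 2 * ∑ e, a.1 e * b.1 e :=
  rfl

open Classical in
theorem chainOfOdd_mem_H1 {c : E → K} (hc : ∀ e, c (X.inv e) = -c e)
    (hsum : ∀ x, ∑ e with X.o e = x, c e = 0) : chainOfOdd c hc ∈ X.H1 K := by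
  have hboundary (x : V) : X.boundary K (chainOfOdd c hc) x = ∑ e with X.t e = x, c e := by
    change Finsupp.mapDomain X.t _ x = _
    rw [Finsupp.mapDomain, Finsupp.sum_apply, Finset.sum_filter,
      Finsupp.sum_fintype _ _ fun e => by rw [Finsupp.single_zero, Finsupp.zero_apply]]
    exact Finset.sum_congr rfl fun e _ => Finsupp.single_apply
  have hreverse (x : V) : ∑ e with X.t e = x, c e = ∑ e with X.o e = x, c (X.inv e) :=
    Finset.sum_bij' (fun e _ => X.inv e) (fun e _ => X.inv e) (by simp [X.o_inv])
      (by simp [X.t_inv]) (fun e _ => X.inv_inv e) (fun e _ => X.inv_inv e)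
      fun e _ => by rw [X.inv_inv]
  rw [H1, LinearMap.mem_ker]
  ext x
  simp only [hboundary, hreverse, hc, Finset.sum_neg_distrib, hsum, neg_zero, Finsupp.zero_apply]

end Fintype

end DirGraph

section LinearAlgebra

theorem exists_linearMap_comp_eq_of_finrank_eq {L K F M : Type*} [AddCommGroup L]
    [Module.Free ℤ L] [Module.Finite ℤ L] [Field K] [AddCommGroup F] [Module K F] [AddCommGroup M]
    [Module K M] {ρ : L →+ F} (hspan : Submodule.span K (Set.range ρ) = ⊤)
    (hrank : Module.finrank ℤ L = Module.finrank K F) (χ : L →+ M) :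
    ∃ φ : F →ₗ[K] M, ∀ σ, φ (ρ σ) = χ σ := by
  let b := Module.finBasis ℤ L
  have hbasis : ⊤ ≤ Submodule.span K (Set.range (ρ ∘ b)) := by
    rw [← hspan, Submodule.span_le]
    rintro _ ⟨σ, rfl⟩
    rw [← b.sum_repr σ, map_sum]
    refine Submodule.sum_mem _ fun i _ => ?_
    rw [map_zsmul, ← Int.cast_smul_eq_zsmul K]
    exact Submodule.smul_mem _ _ (Submodule.subset_span ⟨i, rfl⟩)
  let B := Module.Basis.mk
    (linearIndependent_of_top_le_span_of_card_eq_finrank hbasis (by simpa using hrank)) hbasis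
  have hB (i) : B i = ρ (b i) := Module.Basis.mk_apply _ hbasis i
  let φ : F →ₗ[K] M := B.constr K (χ ∘ b)
  have hφ : (φ.toAddMonoidHom.comp ρ).toIntLinearMap = χ.toIntLinearMap := by
    refine b.ext fun i => ?_
    change φ (ρ (b i)) = χ (b i)
    rw [← hB, Module.Basis.constr_basis, Function.comp_apply]
  exact ⟨φ, LinearMap.congr_fun hφ⟩

theorem exists_linearIsometryEquiv_eq_smul {F G : Type*} [NormedAddCommGroup F]
    [InnerProductSpace ℝ F] [NormedAddCommGroup G] [InnerProductSpace ℝ G] {T : F →ₗ[ℝ] G}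
    (hsurj : Function.Surjective T) {c : ℝ} (hc : 0 < c)
    (hT : ∀ x y, inner ℝ (T x) (T y) = c * inner ℝ x y) :
    ∃ s : ℝ, 0 < s ∧ ∃ S : F ≃ₗᵢ[ℝ] G, ∀ x, S x = s • T x := by
  have hs : 0 < (√c)⁻¹ := inv_pos.2 (Real.sqrt_pos.2 hc)
  have hinner (x y : F) : inner ℝ (((√c)⁻¹ • T) x) (((√c)⁻¹ • T) y) = inner ℝ x y := by
    rw [LinearMap.smul_apply, LinearMap.smul_apply, real_inner_smul_left, real_inner_smul_right, hT,
      ← mul_assoc, ← mul_inv, Real.mul_self_sqrt hc.le, inv_mul_cancel_left₀ hc.ne']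
  have hinj : Function.Injective ((√c)⁻¹ • T) :=
    (((√c)⁻¹ • T).isometryOfInner hinner).injective
  have hsurj' : Function.Surjective ((√c)⁻¹ • T) := fun y => by
    obtain ⟨x, rfl⟩ := hsurj y
    exact ⟨√c • x, by rw [LinearMap.smul_apply, map_smul, inv_smul_smul₀ (inv_pos.1 hs).ne']⟩
  exact ⟨(√c)⁻¹, hs, (LinearEquiv.ofBijective _ ⟨hinj, hsurj'⟩).isometryOfInner hinner,
    fun _ => rfl⟩

end LinearAlgebra

/-! ### Standard realizations -/

section Standard

section Pairing

variable {V₀ E₀ F : Type*} [Fintype E₀] [NormedAddCommGroup F] [InnerProductSpace ℝ F]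
  {X₀ : DirGraph V₀ E₀} {v : E₀ → F}

/-- The 1-chain `e ↦ ⟨y, v e⟩`, as a linear function of `y`. -/
noncomputable def pairingChain (hodd : ∀ e, v (X₀.inv e) = -v e) : F →ₗ[ℝ] X₀.chains ℝ where
  toFun y := chainOfOdd (fun e => inner ℝ y (v e)) fun e => by rw [hodd, inner_neg_right]
  map_add' x y := Subtype.ext (Finsupp.ext fun _ => inner_add_left x y _)
  map_smul' r x := Subtype.ext (Finsupp.ext fun _ => real_inner_smul_left x _ r)

theorem pairingChain_apply (hodd : ∀ e, v (X₀.inv e) = -v e) (y : F) (e : E₀) :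
    (pairingChain hodd y).1 e = inner ℝ y (v e) :=
  rfl

theorem inner_pairingChain (hodd : ∀ e, v (X₀.inv e) = -v e) (x y : F) :
    inner ℝ (pairingChain hodd x) (pairingChain hodd y) =
      1 / 2 * inner ℝ (frameOperator v x) y := by
  rw [inner_chains, inner_frameOperator]
  rfl

end Pairing

variable {V E V₀ E₀ L : Type*} {d : ℕ} {X : DirGraph V E} {X₀ : DirGraph V₀ E₀} {pV : V → V₀}
  {pE : E → E₀} {Φ : V → EuclideanSpace ℝ (Fin d)} {v : E₀ → EuclideanSpace ℝ (Fin d)} [Fintype E₀]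

theorem mem_orthogonal_vanishingSpace_iff (hp : ∀ e, pE (X.inv e) = X₀.inv (pE e))
    {c : X₀.chains ℝ} : c ∈ (vanishingSpace X X₀ pE)ᗮ ↔
      ∀ z ∈ X.H1 ℤ, Finsupp.linearCombination ℤ (c.1 ∘ pE) z.1 = 0 := by
  have hpairing {z : E →₀ ℤ} {w : X₀.chains ℝ}
      (hw : ∀ e₀, w.1 e₀ = (Finsupp.mapDomain pE z e₀ : ℤ)) :
      inner ℝ c w = 1 / 2 * Finsupp.linearCombination ℤ (c.1 ∘ pE) z := by
    rw [← Finsupp.linearCombination_mapDomain, Finsupp.linearCombination_apply,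
      Finsupp.sum_fintype _ _ (by simp), inner_chains]
    simp only [hw, zsmul_eq_mul, mul_comm]
  rw [vanishingSpace, mem_orthogonal_span_iff]
  constructor
  · intro h z hz
    have hodd (e₀ : E₀) : ((Finsupp.mapDomain pE z.1 (X₀.inv e₀) : ℤ) : ℝ) =
        -(Finsupp.mapDomain pE z.1 e₀ : ℤ) := by
      rw [mapDomain_mem_chains hp z.2 e₀, Int.cast_neg]
    have hzero := h (chainOfOdd _ hodd) ⟨z, hz, fun _ => rfl⟩
    rwa [hpairing fun _ => rfl, mul_eq_zero_iff_left (by norm_num)] at hzero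
  · rintro h w ⟨z, hz, hw⟩
    rw [hpairing hw, h z hz, mul_zero]

theorem mem_orthogonal_vanishingSpace_iff_exists_potential (hX : X.Connected)
    (hp : ∀ e, pE (X.inv e) = X₀.inv (pE e)) {c : X₀.chains ℝ} :
    c ∈ (vanishingSpace X X₀ pE)ᗮ ↔ ∃ f : V → ℝ, ∀ e, f (X.t e) - f (X.o e) = c.1 (pE e) := by
  rw [mem_orthogonal_vanishingSpace_iff hp]
  constructor
  · exact hX.exists_eq_coboundary fun e => by rw [Function.comp_apply, hp, c.2, Function.comp_apply]
  · rintro ⟨f, hf⟩ z hz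
    rw [show c.1 ∘ pE = _ from funext fun e => (hf e).symm]
    exact linearCombination_coboundary f hz

theorem inner_standardCochain (e : E₀) (u : vanishingSpacePerp X X₀ pE) :
    inner ℝ (standardCochain X X₀ pE e) u = u.1.1 e := by
  have hharmonic : inner ℝ (harmonicEdge X₀ e) ⟨u.1, u.2.1⟩ = inner ℝ (X₀.edgeChain ℝ e) u.1 :=
    Submodule.inner_orthogonalProjectionOnto_eq_of_mem_right _ _
  rw [standardCochain, Submodule.inner_orthogonalProjectionOnto_eq_of_mem_right,
    ← inner_edgeChain_left X₀ e u.1, ← hharmonic, Submodule.coe_inner]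

theorem IsHarmonic.pairingChain_mem_H1 (hharm : IsHarmonic X₀ v)
    (hodd : ∀ e, v (X₀.inv e) = -v e) (y : EuclideanSpace ℝ (Fin d)) :
    pairingChain hodd y ∈ X₀.H1 ℝ :=
  chainOfOdd_mem_H1 _ fun x => by rw [← inner_sum, hharm x, inner_zero_right]

variable [AddCommGroup L] [AddAction L V] [AddAction L E] {ρ : L →+ EuclideanSpace ℝ (Fin d)}
  (hX : IsTopologicalCrystal d L X X₀ pV pE)
include hX

theorem pairingChain_mem_vanishingSpacePerp (hv : IsBuildingCochain X pE Φ v)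
    (hharm : IsHarmonic X₀ v) (hodd : ∀ e, v (X₀.inv e) = -v e) (y : EuclideanSpace ℝ (Fin d)) :
    pairingChain hodd y ∈ vanishingSpacePerp X X₀ pE :=
  ⟨hharm.pairingChain_mem_H1 hodd y,
    (mem_orthogonal_vanishingSpace_iff_exists_potential hX.connected hX.map_inv).2
      ⟨fun x => inner ℝ y (Φ x), fun e => by rw [pairingChain_apply, hv, inner_sub_right]⟩⟩

theorem exists_pairingChain_eq (hΦ : IsPeriodicRealization Φ ρ) (hv : IsBuildingCochain X pE Φ v)
    (hharm : IsHarmonic X₀ v) (hodd : ∀ e, v (X₀.inv e) = -v e) {c : X₀.chains ℝ}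
    (hc : c ∈ vanishingSpacePerp X X₀ pE) : ∃ y, pairingChain hodd y = c := by
  have := hX.free
  have := hX.finitely_generated
  obtain ⟨f, hf⟩ :=
    (mem_orthogonal_vanishingSpace_iff_exists_potential hX.connected hX.map_inv).1 hc.2
  obtain ⟨χ, hχ⟩ := hX.connected.exists_addMonoidHom_of_vadd (L := L) (f := f) fun σ e => by
    rw [← hX.vadd_t, ← hX.vadd_o, hf, hf, hX.map_vadd_edge]
  obtain ⟨φ, hφ⟩ := exists_linearMap_comp_eq_of_finrank_eq hΦ.span_eq_top
    (by rw [hX.rank_eq, finrank_euclideanSpace_fin]) χ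
  let y := (InnerProductSpace.toDual ℝ _).symm (LinearMap.toContinuousLinearMap φ)
  have hy (w) : inner ℝ y w = φ w := InnerProductSpace.toDual_symm_apply
  obtain ⟨h, hh⟩ := hX.exists_eq_comp_of_vadd (f := fun x => f x - inner ℝ y (Φ x)) fun σ x => by
    rw [hχ, hΦ.equivariant, inner_add_right, hy (ρ σ), hφ, add_sub_add_right_eq_sub]
  refine ⟨y, (sub_eq_zero.1 (eq_zero_of_mem_H1_of_eq_coboundary
    (sub_mem hc.1 (hharm.pairingChain_mem_H1 hodd y)) (h := h) fun e₀ => ?_)).symm⟩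
  obtain ⟨e, rfl⟩ := hX.surjective_edge e₀
  have hh' (x) : h (pV x) = f x - inner ℝ y (Φ x) := (congrFun hh x).symm
  rw [hX.map_t, hX.map_o, hh', hh', Submodule.coe_sub, Finsupp.sub_apply, pairingChain_apply,
    ← hf e, hv e, inner_sub_right, sub_sub_sub_comm]

theorem isStandardRealization_of_isTightFrame (hΦ : IsPeriodicRealization Φ ρ)
    (hv : IsBuildingCochain X pE Φ v) (hharm : IsHarmonic X₀ v) (htight : IsTightFrame v) :
    IsStandardRealization X X₀ pE Φ := by
  obtain ⟨-, α, hα, hframe⟩ := htight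
  have hodd := hX.buildingCochain_inv hv
  let T : EuclideanSpace ℝ (Fin d) →ₗ[ℝ] vanishingSpacePerp X X₀ pE :=
    (pairingChain hodd).codRestrict _ (pairingChain_mem_vanishingSpacePerp hX hv hharm hodd)
  have hsurj : Function.Surjective T := fun c =>
    let ⟨y, hy⟩ := exists_pairingChain_eq hX hΦ hv hharm hodd c.2
    ⟨y, Subtype.ext hy⟩
  have hT (x y) : inner ℝ (T x) (T y) = α / 2 * inner ℝ x y := by
    rw [Submodule.coe_inner]
    change inner ℝ (pairingChain hodd x) (pairingChain hodd y) = _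
    rw [inner_pairingChain, frameOperator_apply, hframe, real_inner_smul_left]
    ring
  obtain ⟨s, hs, S, hS⟩ := exists_linearIsometryEquiv_eq_smul hsurj (half_pos hα) hT
  have hstd (e : E₀) : S.symm (standardCochain X X₀ pE e) = s • v e := by
    refine ext_inner_right ℝ fun y => ?_
    calc inner ℝ (S.symm (standardCochain X X₀ pE e)) y
        = inner ℝ (standardCochain X X₀ pE e) (S y) := by
          rw [← S.inner_map_map, S.apply_symm_apply]
      _ = s * inner ℝ y (v e) := by rw [inner_standardCochain, hS]; rfl
      _ = inner ℝ (s • v e) y := by rw [real_inner_smul_left, real_inner_comm]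
  refine ⟨fun x => s • Φ x, ⟨S.symm, fun e => ?_⟩, s⁻¹, .refl ℝ _, 0, inv_pos.2 hs, fun x => ?_⟩
  · simp only [hstd, hv e, smul_sub]
  · rw [LinearIsometryEquiv.coe_refl, id, inv_smul_smul₀ hs.ne', add_zero]

end Standard

end TopCrystal

theorem theorem7p3_general {V E V₀ E₀ L : Type*} [Fintype E₀] [AddCommGroup L] [AddAction L V]
    [AddAction L E] {d : ℕ}
    (X : TopCrystal.DirGraph V E) (X₀ : TopCrystal.DirGraph V₀ E₀) (pV : V → V₀) (pE : E → E₀)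
    (hX : TopCrystal.IsTopologicalCrystal d L X X₀ pV pE)
    (hdeg : ∀ x : V, 3 ≤ X.degree x)
    (Φ : V → EuclideanSpace ℝ (Fin d)) (ρ : L →+ EuclideanSpace ℝ (Fin d))
    (hΦ : TopCrystal.IsPeriodicRealization Φ ρ)
    (hinj : Function.Injective (X.plMap Φ))
    (Γ : Subgroup (EuclideanSpace ℝ (Fin d) ≃ᵃⁱ[ℝ] EuclideanSpace ℝ (Fin d)))
    (hpres : ∀ g ∈ Γ, g '' Set.range (X.plMap Φ) = Set.range (X.plMap Φ))
    (hirr : TopCrystal.ActsIrreducibly (TopCrystal.pointGroup Γ))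
    (hfix : ∀ x : V, {w : EuclideanSpace ℝ (Fin d) |
      ∀ g ∈ TopCrystal.isotropyGroup Γ (Φ x), TopCrystal.linearPart g w = w} = {0}) :
    TopCrystal.IsStandardRealization X X₀ pE Φ ∧
      ∃ v : E₀ → EuclideanSpace ℝ (Fin d), TopCrystal.IsBuildingCochain X pE Φ v ∧
        TopCrystal.IsTightFrame v ∧ TopCrystal.IsHarmonic X₀ v := by
  have hlf := hΦ.locallyFinite_edgeSegment hX
  obtain ⟨v, hv⟩ := hΦ.exists_isBuildingCochain hX
  have hharm : TopCrystal.IsHarmonic X₀ v :=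
    TopCrystal.isHarmonic_of_forall_linearPart_eq hX hdeg hinj hlf hv fun x w hw =>
      (hfix x).subset fun g hg => hw g ⟨hpres g hg.1, hg.2⟩
  have htight : TopCrystal.IsTightFrame v := by
    refine TopCrystal.isTightFrame_of_actsIrreducibly
      (TopCrystal.span_range_buildingCochain hX.connected hΦ hv) hirr ?_
    rintro _ ⟨g, hg, rfl⟩ x
    exact TopCrystal.frameOperator_linearPart_comm hX hΦ hinj hdeg hv (hpres g hg) x
  exact ⟨TopCrystal.isStandardRealization_of_isTightFrame hX hΦ hv hharm htight,
    v, hv, htight, hharm⟩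

theorem theorem7p3 {V E V₀ E₀ L : Type*} [Fintype E₀] [AddCommGroup L] [AddAction L V]
    [AddAction L E] {d : ℕ}
    -- a topological crystal `X` over `X₀`, all of whose degrees are at least three
    (X : TopCrystal.DirGraph V E) (X₀ : TopCrystal.DirGraph V₀ E₀) (pV : V → V₀) (pE : E → E₀)
    (hX : TopCrystal.IsTopologicalCrystal d L X X₀ pV pE)
    (hdeg : ∀ x : V, 3 ≤ X.degree x)
    -- an injective periodic realization `Φ` with period homomorphism `ρ`
    (Φ : V → EuclideanSpace ℝ (Fin d)) (ρ : L →+ EuclideanSpace ℝ (Fin d))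
    (hΦ : TopCrystal.IsPeriodicRealization Φ ρ)
    (hinj : Function.Injective (X.plMap Φ))
    -- a group `Γ` of congruence transformations that preserves the image of `Φ` and contains
    -- the period lattice
    (Γ : Subgroup (EuclideanSpace ℝ (Fin d) ≃ᵃⁱ[ℝ] EuclideanSpace ℝ (Fin d)))
    (hpres : ∀ g ∈ Γ, g '' Set.range (X.plMap Φ) = Set.range (X.plMap Φ))
    (hper : ∀ σ : L,
      AffineIsometryEquiv.constVAdd ℝ (EuclideanSpace ℝ (Fin d)) (ρ σ) ∈ Γ)
    -- the point group acts irreducibly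
    (hirr : TopCrystal.ActsIrreducibly (TopCrystal.pointGroup Γ))
    -- the isotropy group of each vertex, acting through linear parts, fixes only zero
    (hfix : ∀ x : V, {w : EuclideanSpace ℝ (Fin d) |
      ∀ g ∈ TopCrystal.isotropyGroup Γ (Φ x), TopCrystal.linearPart g w = w} = {0}) :
    TopCrystal.IsStandardRealization X X₀ pE Φ ∧
      ∃ v : E₀ → EuclideanSpace ℝ (Fin d), TopCrystal.IsBuildingCochain X pE Φ v ∧
        TopCrystal.IsTightFrame v ∧ TopCrystal.IsHarmonic X₀ v :=
  theorem7p3_general X X₀ pV pE hX hdeg Φ ρ hΦ hinj Γ hpres hirr hfix
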